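/- An oriented virtual knot diagram is a smooth immersion of the circle in the plane with finitely many transverse double points and no other multiple points, each double point being marked as classical (with an over- and an under-strand) or virtual. Its Gauss diagram has one signed chord for each classical crossing, directed from the over- to the under-crossing point. Two diagrams represent the same virtual knot (are virtually isotopic) if their Gauss diagrams are related by a finite sequence of isotopies and Reidemeister moves of Gauss diagrams. The index of a chord $c$, drawn vertically upwards, is $I(c)=r_+-r_-+\ell_--\ell_+$, where $r_\pm$ (resp. $\ell_\pm$) is the number of chords of sign $\pm1$ that intersect $c$ and have their arrowhead to the right (resp. left) of $c$. A diagram is almost classical if its short arcs (the arcs between consecutive classical crossing points) admit an integer Alexander numbering: at each classical crossing the incoming and the outgoing arc on the left of the crossing carry one number $\lambda$, and those on the right carry $\lambda+1$. A virtual knot is almost classical if it has an almost classical diagram. Manturov projection $P_f$, for the total Gaussian parity $f$, turns every classical crossing with $I(c)\neq 0$ into a virtual one, and $P_f^\infty(K)=P_f^{n}(K)$ for the least $n$ with $P_f^{n+1}(K)=P_f^n(K)$. For an integer $q\ge 1$, a diagram is $q$-periodic if it misses the origin and is invariant under the rotation by $2\pi/q$ about the origin. Its quotient $K_*$ is obtained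 by closing up one sector of angle $2\pi/q$ by concentric arcs, that is, $K_*$ is the image of $K$ under $re^{i\theta}\mapsto re^{iq\theta}$, traversed once. **Theorem.** Let $q\ge1$ and let $K$ be a $q$-periodic virtual knot diagram. 1. If $K$ represents an almost classical knot, then $\bar K=P_f^\infty(K)$ is a $q$-periodic almost classical diagram, and it represents the same virtual knot as $K$. 2. Any two classical crossings of $K$ in the same orbit of the rotation group $\mathbb Z/q$ have the same index. Under $re^{i\theta}\mapsto re^{iq\theta}$ every classical crossing of $K$ corresponds to a classical crossing of the quotient $K_*$, every classical crossing of $K_*$ arises in this way, and corresponding crossings $c$ of $K$ and $c_*$ of $K_*$ satisfy $I(c)=I(c_*)$. 3. If $K$ is an almost classical diagram, then so is its quotient $K_*$. -/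

import Mathlib

open scoped ContDiff

/-! ### Gauss diagrams

The base circle is `UnitAddCircle = ℝ ⧸ ℤ`, oriented counterclockwise, with its cyclic order;
`Set.cIoo x y` is the open arc that runs counterclockwise from `x` to `y`. -/

/-- A signed, directed chord: it points from the over-crossing point `tail` to the
under-crossing point `head`, and `sign` is the writhe of the crossing. -/
@[ext] structure Chord where
  tail : UnitAddCircle
  head : UnitAddCircle
  sign : ℤˣ

/-- The image of a chord under a map of the base circle. -/
def Chord.map (f : UnitAddCircle → UnitAddCircle) (c : Chord) : Chord :=
  ⟨f c.tail, f c.head, c.sign⟩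

/-- A Gauss diagram: finitely many chords on the circle, all of whose endpoints are distinct. -/
@[ext] structure GaussDiagram where
  chords : Set Chord
  finite : chords.Finite
  tail_injOn : Set.InjOn Chord.tail chords
  head_injOn : Set.InjOn Chord.head chords
  tail_ne_head : ∀ c ∈ chords, ∀ d ∈ chords, c.tail ≠ d.head

namespace GaussDiagram

/-- The endpoints of the chords. -/
def endpoints (D : GaussDiagram) : Set UnitAddCircle :=
  {x | ∃ c ∈ D.chords, c.tail = x ∨ c.head = x}

/-- `y` is the first endpoint met after the endpoint `x`, travelling counterclockwise.
The arc from `x` to `y` is then a short arc. -/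
def Next (D : GaussDiagram) (x y : UnitAddCircle) : Prop :=
  x ∈ D.endpoints ∧ y ∈ D.endpoints ∧ x ≠ y ∧ ∀ z ∈ Set.cIoo x y, z ∉ D.endpoints

/-- `x` and `y` are the two ends of a short arc. -/
def Adjacent (D : GaussDiagram) (x y : UnitAddCircle) : Prop :=
  D.Next x y ∨ D.Next y x

/-- `x` and `y` are consecutive endpoints, `x` coming first if `σ = 1` and `y` coming first
if `σ = -1`. -/
def InOrder (D : GaussDiagram) (σ : ℤˣ) (x y : UnitAddCircle) : Prop :=
  (σ = 1 ∧ D.Next x y) ∨ (σ = -1 ∧ D.Next y x)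

/-- The number of chords `d` of sign `ε` that intersect `c` and have their arrowhead to the right
of `c`. If `c` points vertically upwards, the right-hand arc is the arc from the tail of `c` to
its head. -/
noncomputable def rightCount (D : GaussDiagram) (c : Chord) (ε : ℤˣ) : ℕ :=
  {d ∈ D.chords | d.sign = ε ∧ d.head ∈ Set.cIoo c.tail c.head ∧
    d.tail ∈ Set.cIoo c.head c.tail}.ncard

/-- The number of chords `d` of sign `ε` that intersect `c` and have their arrowhead to the left
of `c`. -/
noncomputable def leftCount (D : GaussDiagram) (c : Chord) (ε : ℤˣ) : ℕ :=
  {d ∈ D.chords | d.sign = ε ∧ d.head ∈ Set.cIoo c.head c.tail ∧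
    d.tail ∈ Set.cIoo c.tail c.head}.ncard

/-- The index `r₊ - r₋ + ℓ₋ - ℓ₊` of a chord. -/
noncomputable def index (D : GaussDiagram) (c : Chord) : ℤ :=
  (D.rightCount c 1 : ℤ) - D.rightCount c (-1) + D.leftCount c (-1) - D.leftCount c 1

/-- Alexander numberings. A short arc is recorded by its initial endpoint, so `lam x` is the
number of the short arc that starts at `x`. At a crossing `c`, with `p` and `p'` the endpoints
just before its over- and under-crossing points, the over-strand runs from `lam p` to
`lam c.tail` and the under-strand from `lam p'` to `lam c.head`. The two short arcs on the left
of the crossing carry a common number and the two on its right carry that number plus one;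
the over-strand passes from left to right at a positive crossing, from right to left at a
negative one. -/
def IsAlexanderNumbering (D : GaussDiagram) (lam : UnitAddCircle → ℤ) : Prop :=
  ∀ c ∈ D.chords, ∀ p p' : UnitAddCircle, D.Next p c.tail → D.Next p' c.head →
    lam c.tail = lam p + (c.sign : ℤ) ∧ lam p' = lam c.tail ∧ lam c.head = lam p

/-- A Gauss diagram is almost classical if it has an Alexander numbering. -/
def IsAlmostClassical (D : GaussDiagram) : Prop :=
  ∃ lam : UnitAddCircle → ℤ, D.IsAlexanderNumbering lam

/-- The moves between Gauss diagrams: isotopies and all oriented Reidemeister moves. -/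
inductive Move : GaussDiagram → GaussDiagram → Prop
  /-- The endpoints are moved along the circle without changing their cyclic order (such a
  displacement of finitely many points is induced by an orientation preserving homeomorphism of
  the circle). -/
  | isotopy (D D' : GaussDiagram) (f : UnitAddCircle → UnitAddCircle)
      (inj : Set.InjOn f D.endpoints)
      (orientation : ∀ x ∈ D.endpoints, ∀ y ∈ D.endpoints, ∀ z ∈ D.endpoints,
        (sbtw (f x) (f y) (f z) ↔ sbtw x y z))
      (chords_eq : D'.chords = Chord.map f '' D.chords) : Move D D'
  /-- A chord with adjacent endpoints is added. -/
  | r1 (D D' : GaussDiagram) (c : Chord) (new : c ∉ D.chords)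
      (chords_eq : D'.chords = insert c D.chords)
      (adj : D'.Adjacent c.tail c.head) : Move D D'
  /-- Two chords of opposite signs with adjacent tails and adjacent heads are added. -/
  | r2 (D D' : GaussDiagram) (c d : Chord) (newc : c ∉ D.chords) (newd : d ∉ D.chords)
      (chords_eq : D'.chords = insert c (insert d D.chords))
      (opposite : d.sign = -c.sign)
      (adj_tail : D'.Adjacent c.tail d.tail)
      (adj_head : D'.Adjacent c.head d.head) : Move D D'
  /-- Three strands: the top one meets the other two at `x₁` (over the middle) and `x₂` (over
  the bottom), the middle one at `y₁` (under the top) and `y₂` (over the bottom), the bottom one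
  at `z₁` (under the top) and `z₂` (under the middle). The move reverses the order of the two
  crossings on each strand. For three oriented straight lines in the plane with crossing signs
  `a` (top-middle), `b` (top-bottom), `c` (middle-bottom), the possible orders on the three
  strands are exactly the two described by `δ = 1` and `δ = -1`. -/
  | r3 (D D' : GaussDiagram) (S : Set Chord) (x₁ x₂ y₁ y₂ z₁ z₂ : UnitAddCircle)
      (a b c δ : ℤˣ)
      (chords_eq : D.chords = S ∪ {⟨x₁, y₁, a⟩, ⟨x₂, z₁, b⟩, ⟨y₂, z₂, c⟩})
      (chords_eq' : D'.chords = S ∪ {⟨x₂, y₂, a⟩, ⟨x₁, z₂, b⟩, ⟨y₁, z₁, c⟩})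
      (top : D.InOrder (δ * (a * b * c)) x₁ x₂)
      (middle : D.InOrder (δ * a) y₁ y₂)
      (bottom : D.InOrder (δ * b) z₁ z₂) : Move D D'

/-- Equivalence of Gauss diagrams: the equivalence relation generated by the moves. Its classes
are the (oriented) virtual knots. -/
def Equivalent : GaussDiagram → GaussDiagram → Prop :=
  Relation.EqvGen Move

end GaussDiagram

/-! ### Virtual knot diagrams in the plane -/

/-- The determinant of two plane vectors. -/
def planeDet (z w : ℂ) : ℝ := z.re * w.im - z.im * w.re

/-- An oriented virtual knot diagram: a smooth immersion of the circle in the plane whose only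
multiple points are finitely many transverse double points. `overSet` consists of the parameters
of the over-strands at the classical crossings; a double point is virtual if neither of its
parameters lies in `overSet`. -/
@[ext] structure VirtualKnotDiagram where
  curve : UnitAddCircle → ℂ
  overSet : Set UnitAddCircle
  smooth : ContDiff ℝ ∞ (fun t : ℝ => curve t)
  immersion : ∀ t : ℝ, deriv (fun t : ℝ => curve t) t ≠ 0
  double : ∀ x y z, curve x = curve y → curve y = curve z → x = y ∨ y = z ∨ x = z
  finite_double : {x | ∃ y, y ≠ x ∧ curve y = curve x}.Finite
  transverse : ∀ s t : ℝ, (s : UnitAddCircle) ≠ t → curve s = curve t →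
    planeDet (deriv (fun t : ℝ => curve t) s) (deriv (fun t : ℝ => curve t) t) ≠ 0
  over_crossing : ∀ x ∈ overSet, ∃ y, y ≠ x ∧ curve y = curve x ∧ y ∉ overSet

namespace VirtualKnotDiagram

/-- The velocity of the curve at time `t`. -/
noncomputable def velocity (K : VirtualKnotDiagram) (t : ℝ) : ℂ :=
  deriv (fun t : ℝ => K.curve t) t

/-- The chords given by the classical crossings. A crossing is positive (right-handed) if the
velocities of the over- and the under-strand, in this order, form a positive basis of the
plane. -/
def chordSet (K : VirtualKnotDiagram) : Set Chord :=
  {c | c.tail ∈ K.overSet ∧ c.head ≠ c.tail ∧ K.curve c.head = K.curve c.tail ∧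
    ∃ s t : ℝ, c.tail = s ∧ c.head = t ∧
      0 < ((c.sign : ℤ) : ℝ) * planeDet (K.velocity s) (K.velocity t)}

theorem velocity_eq (K : VirtualKnotDiagram) {s t : ℝ} (h : (s : UnitAddCircle) = t) :
    K.velocity s = K.velocity t := by
  obtain ⟨n, hn⟩ := (QuotientAddGroup.eq_iff_sub_mem.1 h)
  have hs : s = t + n := by
    have h1 : (n : ℝ) = s - t := by simpa using hn
    linarith
  have hf : (fun r : ℝ => K.curve (r + n : ℝ)) = fun r : ℝ => K.curve r := by
    funext r
    have h1 : ((n : ℝ) : UnitAddCircle) = 0 :=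
      (QuotientAddGroup.eq_zero_iff _).2 ⟨n, by simp⟩
    rw [AddCircle.coe_add, h1, add_zero]
  unfold velocity
  rw [hs, ← deriv_comp_add_const, hf]

theorem head_unique (K : VirtualKnotDiagram) {x y z : UnitAddCircle} (hy : y ≠ x)
    (hz : z ≠ x) (hxy : K.curve y = K.curve x) (hxz : K.curve z = K.curve x) : y = z := by
  rcases K.double y x z hxy hxz.symm with h | h | h
  · exact absurd h hy
  · exact absurd h.symm hz
  · exact h

theorem sign_unique (K : VirtualKnotDiagram) {c d : Chord} (hc : c ∈ K.chordSet)
    (hd : d ∈ K.chordSet) (ht : c.tail = d.tail) (hh : c.head = d.head) : c = d := by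
  obtain ⟨-, -, -, s, t, hs, ht', h⟩ := hc
  obtain ⟨-, -, -, s', t', hs', ht'', h'⟩ := hd
  rw [K.velocity_eq (hs.symm.trans (ht.trans hs')),
    K.velocity_eq (ht'.symm.trans (hh.trans ht''))] at h
  refine Chord.ext ht hh ?_
  rcases Int.units_eq_one_or c.sign with h1 | h1 <;>
    rcases Int.units_eq_one_or d.sign with h2 | h2 <;> simp [h1, h2] at h h' ⊢ <;> linarith

theorem chord_eq_of_tail_eq (K : VirtualKnotDiagram) {c d : Chord} (hc : c ∈ K.chordSet)
    (hd : d ∈ K.chordSet) (ht : c.tail = d.tail) : c = d := by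
  refine K.sign_unique hc hd ht ?_
  exact K.head_unique (x := c.tail) hc.2.1 (ht ▸ hd.2.1) hc.2.2.1 (ht ▸ hd.2.2.1)

theorem head_notMem_over (K : VirtualKnotDiagram) {c : Chord} (hc : c ∈ K.chordSet) :
    c.head ∉ K.overSet := by
  obtain ⟨y, hy, hxy, hyo⟩ := K.over_crossing c.tail hc.1
  rwa [K.head_unique hc.2.1 hy hc.2.2.1 hxy]

/-- The Gauss diagram of a virtual knot diagram; virtual crossings are ignored. -/
def gauss (K : VirtualKnotDiagram) : GaussDiagram where
  chords := K.chordSet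
  finite := by
    refine Set.Finite.of_finite_image (f := Chord.tail) (K.finite_double.subset ?_)
      (fun c hc d hd h => K.chord_eq_of_tail_eq hc hd h)
    rintro _ ⟨c, hc, rfl⟩
    exact ⟨c.head, hc.2.1, hc.2.2.1⟩
  tail_injOn := fun c hc d hd h => K.chord_eq_of_tail_eq hc hd h
  head_injOn := by
    intro c hc d hd h
    refine K.chord_eq_of_tail_eq hc hd ?_
    refine K.head_unique (x := c.head) hc.2.1.symm ?_ hc.2.2.1.symm ?_
    · exact fun h' => hd.2.1 (h.symm.trans h'.symm)
    · rw [h]; exact hd.2.2.1.symm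
  tail_ne_head := fun c hc d hd h => K.head_notMem_over hd (h ▸ hc.1)

/-- The point of the plane at which the crossing of a chord lies. -/
def crossingPoint (K : VirtualKnotDiagram) (c : Chord) : ℂ := K.curve c.tail

/-- A virtual knot diagram is almost classical if its short arcs have an Alexander numbering. -/
def IsAlmostClassical (K : VirtualKnotDiagram) : Prop := K.gauss.IsAlmostClassical

/-- Two virtual knot diagrams are virtually isotopic, that is, represent the same virtual knot,
if their Gauss diagrams are equivalent under Reidemeister moves. -/
def VirtuallyIsotopic (K L : VirtualKnotDiagram) : Prop := K.gauss.Equivalent L.gauss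

/-- The virtual knot represented by `K` is almost classical: it has some almost classical
diagram. -/
def RepresentsAlmostClassical (K : VirtualKnotDiagram) : Prop :=
  ∃ L : VirtualKnotDiagram, K.VirtuallyIsotopic L ∧ L.IsAlmostClassical

/-- Manturov projection for the total Gaussian parity: every odd classical crossing, that is,
every one whose index is not zero, is turned into a virtual crossing. On the Gauss diagram, the
odd chords are removed. -/
def projection (K : VirtualKnotDiagram) : VirtualKnotDiagram where
  __ := K
  overSet := {x | ∃ c ∈ K.gauss.chords, c.tail = x ∧ K.gauss.index c = 0}
  over_crossing := by
    rintro _ ⟨c, hc, rfl, -⟩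
    refine ⟨c.head, hc.2.1, hc.2.2.1, ?_⟩
    rintro ⟨d, hd, h, -⟩
    exact K.gauss.tail_ne_head d hd c hc h

theorem projection_over_subset (K : VirtualKnotDiagram) : K.projection.overSet ⊆ K.overSet := by
  rintro _ ⟨c, hc, rfl, -⟩
  exact hc.1

theorem over_finite (K : VirtualKnotDiagram) : K.overSet.Finite :=
  K.finite_double.subset fun x hx => by
    obtain ⟨y, h1, h2, -⟩ := K.over_crossing x hx
    exact ⟨y, h1, h2⟩

theorem exists_projection_stable (K : VirtualKnotDiagram) :
    ∃ n : ℕ, projection^[n + 1] K = projection^[n] K := by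
  induction h : K.overSet.ncard using Nat.strong_induction_on generalizing K with
  | _ m ih =>
    by_cases hK : K.projection = K
    · exact ⟨0, by simpa using hK⟩
    · have hne : K.projection.overSet ≠ K.overSet := fun h' =>
        hK (VirtualKnotDiagram.ext rfl h')
      have hlt : K.projection.overSet.ncard < m := by
        rw [← h]
        exact Set.ncard_lt_ncard (K.projection_over_subset.ssubset_of_ne hne) K.over_finite
      obtain ⟨n, hn⟩ := ih _ hlt K.projection rfl
      exact ⟨n + 1, by simpa only [Function.iterate_succ_apply] using hn⟩

open Classical in
/-- Stable Manturov projection: the projection iterated `n` times, where `n` is the least number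
after which the iterates no longer change. -/
noncomputable def stableProjection (K : VirtualKnotDiagram) : VirtualKnotDiagram :=
  projection^[Nat.find K.exists_projection_stable] K

/-- The rotation of the plane about the origin by the angle `2π / q`, as a complex number. -/
noncomputable def rotation (q : ℕ) : ℂ := Complex.exp (2 * Real.pi * Complex.I / q)

/-- A diagram is `q`-periodic if it misses the origin and is invariant under the rotation by
`2π / q`: the rotated diagram, with its crossing information, is the given one up to an
orientation preserving diffeomorphism of the parameter circle (which is described by its lift
`Φ` to the real line). -/
def IsPeriodic (K : VirtualKnotDiagram) (q : ℕ) : Prop :=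
  (∀ x, K.curve x ≠ 0) ∧
  ∃ Φ : ℝ → ℝ, ContDiff ℝ ∞ Φ ∧ (∀ t, 0 < deriv Φ t) ∧ (∀ t, Φ (t + 1) = Φ t + 1) ∧
    ∀ t : ℝ, K.curve (Φ t) = rotation q * K.curve t ∧
      ((Φ t : UnitAddCircle) ∈ K.overSet ↔ (t : UnitAddCircle) ∈ K.overSet)

/-- The map `r e^{iθ} ↦ r e^{iqθ}`. It opens the sector of angle `2π / q` up to the whole
plane and glues the two edges of the sector along concentric circles; two points other than the
origin have the same image if and only if they differ by a multiple of the rotation by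
`2π / q`. -/
noncomputable def unfold (q : ℕ) (z : ℂ) : ℂ := (‖z‖ : ℂ) * (z / (‖z‖ : ℂ)) ^ q

/-- `L` is the quotient of the `q`-periodic diagram `K`, that is, one fundamental sector of `K`
closed up by concentric arcs: `L` is the image of `K` under `r e^{iθ} ↦ r e^{iqθ}`, traversed
once while `K` runs through one of its `q` periods, with the crossing information of `K`.
(`P` is the lift to the real line of the `q`-fold covering of parameter circles.) -/
def IsQuotient (K : VirtualKnotDiagram) (q : ℕ) (L : VirtualKnotDiagram) : Prop :=
  ∃ P : ℝ → ℝ, ContDiff ℝ ∞ P ∧ (∀ t, 0 < deriv P t) ∧ (∀ t, P (t + 1) = P t + q) ∧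
    ∀ t : ℝ, L.curve (P t) = unfold q (K.curve t) ∧
      ((P t : UnitAddCircle) ∈ L.overSet ↔ (t : UnitAddCircle) ∈ K.overSet)

end VirtualKnotDiagram

/-! Everything is controlled by an integer function on the circle, `potential`, which jumps by the
sign of a chord at its tail, by minus the sign at its head, and is otherwise constant along short
arcs. Walking from one end of a chord to the other, the jumps of the chords met twice cancel and
those of the crossing chords remain, so the index of `c` is the drop of the potential from tail to
head, minus the sign of `c` (`index_eq_potential`). An Alexander numbering has the same jumps as the
potential, hence differs from it by a constant on the endpoints; what its definition demands beyond
the jumps is that all indices vanish (`isAlmostClassical_iff`).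

A diagram fixed by the projection has only chords of index zero, so the stable projection is always
almost classical. That it represents the same knot follows from `Equivalent.evenPart`: deleting the
odd chords respects every move, and leaves an almost classical representative unchanged. The third
Reidemeister move is the serious case. There the three indices satisfy a linear relation, so exactly
one odd chord is impossible; if exactly two are odd, the surviving chord slides into the vacated
places, which is an isotopy.

The rotation acts on the parameter circle preserving cyclic order, chords and signs, hence indices,
so the projection deletes whole orbits and periodicity survives. The quotient map is a covering of
parameter circles that takes chords to chords and short arcs to short arcs (`next_of_covering`). The
two potentials then have matching jumps, so their difference along the covering is constant on
endpoints and indices agree (`index_covering`). By the index criterion, almost classicality passes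
to the quotient. -/

/-! ### The cyclic order of the circle -/

/-- The representative in `[0, 1)` of a point of the circle. -/
noncomputable def circleRep (x : UnitAddCircle) : ℝ := (AddCircle.equivIco 1 0 x : ℝ)

theorem coe_circleRep (x : UnitAddCircle) : (circleRep x : UnitAddCircle) = x :=
  AddCircle.coe_equivIco

theorem circleRep_mem (x : UnitAddCircle) : 0 ≤ circleRep x ∧ circleRep x < 1 := by
  have h := (AddCircle.equivIco 1 0 x).2
  simpa [circleRep] using h

theorem circleRep_injective : Function.Injective circleRep := fun x y h => by
  rw [← coe_circleRep x, h, coe_circleRep]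

theorem coe_add_int (t : ℝ) (n : ℤ) : ((t + n : ℝ) : UnitAddCircle) = t := by
  have h1 : ((n : ℝ) : UnitAddCircle) = 0 :=
    (QuotientAddGroup.eq_zero_iff _).2 ⟨n, by simp⟩
  rw [AddCircle.coe_add, h1, add_zero]

theorem coe_eq_iff_exists_int {s t : ℝ} :
    (s : UnitAddCircle) = t ↔ ∃ n : ℤ, s = t + n := by
  constructor
  · intro h
    obtain ⟨n, hn⟩ := QuotientAddGroup.eq_iff_sub_mem.1 h
    refine ⟨n, ?_⟩
    have h1 : (n : ℝ) = s - t := by simpa using hn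
    linarith
  · rintro ⟨n, rfl⟩
    exact coe_add_int t n

/-- Every point of the circle has a lift in `[a, a + 1)`. -/
theorem exists_lift (a : ℝ) (x : UnitAddCircle) :
    ∃ t : ℝ, a ≤ t ∧ t < a + 1 ∧ (t : UnitAddCircle) = x := by
  have h := (AddCircle.equivIco 1 a x).2
  exact ⟨_, h.1, h.2, AddCircle.coe_equivIco⟩

theorem sbtw_coe_iff {a b c : ℝ} (hb : a ≤ b) (hb' : b < a + 1) (hc : a ≤ c) (hc' : c < a + 1) :
    sbtw (a : UnitAddCircle) b c ↔ a < b ∧ b < c := by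
  have hc1 : toIcoMod one_pos a c = c := (toIcoMod_eq_self one_pos).2 ⟨hc, hc'⟩
  rw [← sbtw_cyclic, sbtw_iff_not_btw]
  have := @QuotientAddGroup.btw_coe_iff ℝ _ _ _ _ 1 ⟨one_pos⟩ a c b
  rw [show btw (a : UnitAddCircle) c b ↔ _ from this, hc1, not_le]
  rcases hb.eq_or_lt with rfl | h
  · have : toIocMod one_pos a a = a + 1 := toIocMod_apply_left _ _
    rw [this]
    constructor
    · intro h; linarith
    · intro h; linarith [h.1]
  · rw [(toIocMod_eq_self one_pos).2 ⟨h, hb'.le⟩]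
    simp [h]

/-- Cutting the circle at `0` turns cyclic order into the linear order of real representatives,
where finite case analysis applies. -/
theorem sbtw_iff_circleRep {x y z : UnitAddCircle} :
    sbtw x y z ↔ (circleRep x < circleRep y ∧ circleRep y < circleRep z) ∨
      (circleRep y < circleRep z ∧ circleRep z < circleRep x) ∨
      (circleRep z < circleRep x ∧ circleRep x < circleRep y) := by
  obtain ⟨hx, hx'⟩ := circleRep_mem x
  obtain ⟨hy, hy'⟩ := circleRep_mem y
  obtain ⟨hz, hz'⟩ := circleRep_mem z
  have key : ∀ x y z : UnitAddCircle, circleRep x ≤ circleRep y → circleRep x ≤ circleRep z →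
      (sbtw x y z ↔ circleRep x < circleRep y ∧ circleRep y < circleRep z) := by
    intro x y z hxy hxz
    have h := sbtw_coe_iff hxy (by linarith [circleRep_mem x, circleRep_mem y]) hxz
      (by linarith [circleRep_mem x, circleRep_mem z])
    simpa only [coe_circleRep] using h
  rcases le_total (circleRep x) (circleRep y) with h1 | h1
  · rcases le_total (circleRep x) (circleRep z) with h2 | h2
    · rw [key x y z h1 h2]; grind
    · rw [sbtw_cyclic, key z x y h2 (h2.trans h1)]; grind
  · rcases le_total (circleRep y) (circleRep z) with h2 | h2
    · rw [← sbtw_cyclic, key y z x h2 h1]; grind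
    · rw [sbtw_cyclic, key z x y (h2.trans h1) h2]; grind

theorem mem_cIoo_coe_iff {s t : ℝ} (hst : s < t) (ht : t < s + 1) {x : UnitAddCircle} :
    x ∈ Set.cIoo (s : UnitAddCircle) t ↔ ∃ r : ℝ, s < r ∧ r < t ∧ (r : UnitAddCircle) = x := by
  rw [Set.mem_cIoo]
  constructor
  · intro h
    obtain ⟨r, h1, h2, rfl⟩ := exists_lift s x
    obtain ⟨h3, h4⟩ := (sbtw_coe_iff h1 h2 hst.le ht).1 h
    exact ⟨r, h3, h4, rfl⟩
  · rintro ⟨r, h1, h2, rfl⟩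
    exact (sbtw_coe_iff h1.le (h2.trans ht) hst.le ht).2 ⟨h1, h2⟩

/-- The difference of the indicator functions of `[p, 1)` and `[p', 1)`. -/
noncomputable def arcStep (p p' x : UnitAddCircle) : ℤ :=
  (if circleRep p ≤ circleRep x then 1 else 0) - (if circleRep p' ≤ circleRep x then 1 else 0)

/-! ### The potential of a Gauss diagram and the index criterion for Alexander numberings. -/

namespace GaussDiagram

theorem tail_mem_endpoints {D : GaussDiagram} {c : Chord} (hc : c ∈ D.chords) :
    c.tail ∈ D.endpoints := ⟨c, hc, Or.inl rfl⟩

theorem head_mem_endpoints {D : GaussDiagram} {c : Chord} (hc : c ∈ D.chords) :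
    c.head ∈ D.endpoints := ⟨c, hc, Or.inr rfl⟩

theorem endpoints_finite (D : GaussDiagram) : D.endpoints.Finite := by
  refine ((D.finite.image Chord.tail).union (D.finite.image Chord.head)).subset ?_
  rintro x ⟨c, hc, rfl | rfl⟩
  · exact Or.inl ⟨c, hc, rfl⟩
  · exact Or.inr ⟨c, hc, rfl⟩

theorem Next.arcStep_eq {D : GaussDiagram} {p p' : UnitAddCircle} (h : D.Next p p') :
    ∃ k : ℤ, ∀ x ∈ D.endpoints, arcStep p p' x = k + if x = p then 1 else 0 := by
  obtain ⟨hp, hp', hne, hE⟩ := h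
  -- The only endpoint in the half-open arc from `p` to `p'` is `p`. The constant is `-1` when this
  -- arc runs over the cut at `0`.
  refine ⟨if circleRep p < circleRep p' then 0 else -1, fun x hx => ?_⟩
  have h1 : ¬ sbtw p x p' := fun h => hE x h hx
  rw [sbtw_iff_circleRep] at h1
  have h2 : circleRep p ≠ circleRep p' := fun h => hne (circleRep_injective h)
  simp only [← circleRep_injective.eq_iff (a := x)]
  unfold arcStep
  split_ifs <;> grind

/-- How the indicator function of `[p, 1)` changes from `x` to the next endpoint `y`. -/
theorem Next.arcStep_sub {D : GaussDiagram} {x y : UnitAddCircle} (h : D.Next x y)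
    {p p' : UnitAddCircle} (hp : p ∈ D.endpoints) (hp' : p' ∈ D.endpoints) :
    arcStep p p' y = arcStep p p' x + ((if p = y then 1 else 0) - if p' = y then 1 else 0) := by
  obtain ⟨-, -, hne, hE⟩ := h
  have h1 : ¬ sbtw x p y := fun h => hE p h hp
  have h1' : ¬ sbtw x p' y := fun h => hE p' h hp'
  rw [sbtw_iff_circleRep] at h1 h1'
  have h2 : circleRep x ≠ circleRep y := fun h => hne (circleRep_injective h)
  simp only [← circleRep_injective.eq_iff]
  unfold arcStep
  split_ifs <;> grind

/-- The sum of the signed steps of the chords. It jumps by the sign of a chord at its tail and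
by minus the sign at its head. -/
noncomputable def potential (D : GaussDiagram) (x : UnitAddCircle) : ℤ :=
  ∑ c ∈ D.finite.toFinset, (c.sign : ℤ) * arcStep c.tail c.head x

/-- The jump of the potential at a point. -/
noncomputable def jump (D : GaussDiagram) (x : UnitAddCircle) : ℤ :=
  ∑ c ∈ D.finite.toFinset,
    (c.sign : ℤ) * ((if c.tail = x then 1 else 0) - if c.head = x then 1 else 0)

theorem jump_tail {D : GaussDiagram} {c : Chord} (hc : c ∈ D.chords) :
    D.jump c.tail = c.sign := by
  unfold jump
  rw [Finset.sum_eq_single c]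
  · simp [(D.tail_ne_head c hc c hc).symm]
  · intro d hd hdc
    have hd' : d ∈ D.chords := by simpa using hd
    rw [if_neg (fun h => hdc (D.tail_injOn hd' hc h)), if_neg (D.tail_ne_head c hc d hd').symm]
    simp
  · intro h; simp [hc] at h

theorem jump_head {D : GaussDiagram} {c : Chord} (hc : c ∈ D.chords) :
    D.jump c.head = -c.sign := by
  unfold jump
  rw [Finset.sum_eq_single c]
  · simp [D.tail_ne_head c hc c hc]
  · intro d hd hdc
    have hd' : d ∈ D.chords := by simpa using hd
    rw [if_neg (fun h => hdc (D.head_injOn hd' hc h)), if_neg (D.tail_ne_head d hd' c hc)]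
    simp
  · intro h; simp [hc] at h

theorem Next.potential_eq {D : GaussDiagram} {x y : UnitAddCircle} (h : D.Next x y) :
    D.potential y = D.potential x + D.jump y := by
  unfold potential jump
  rw [← Finset.sum_add_distrib]
  refine Finset.sum_congr rfl fun c hc => ?_
  have hc' : c ∈ D.chords := by simpa using hc
  rw [h.arcStep_sub (tail_mem_endpoints hc') (head_mem_endpoints hc')]
  ring

/-- Puts the four cardinalities into one signed sum, to be compared with the potential chord by
chord. -/
theorem index_eq_sum (D : GaussDiagram) (c : Chord) :
    D.index c = ∑ d ∈ D.finite.toFinset, (d.sign : ℤ) *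
      ((open Classical in if d.head ∈ Set.cIoo c.tail c.head ∧ d.tail ∈ Set.cIoo c.head c.tail
          then 1 else 0) -
        (open Classical in if d.head ∈ Set.cIoo c.head c.tail ∧ d.tail ∈ Set.cIoo c.tail c.head
          then 1 else 0)) := by
  classical
  have key : ∀ (ε : ℤˣ) (p : Chord → Prop),
      (({d ∈ D.chords | d.sign = ε ∧ p d}.ncard : ℕ) : ℤ) =
        ∑ d ∈ D.finite.toFinset, if d.sign = ε ∧ p d then 1 else 0 := by
    intro ε p
    have : {d ∈ D.chords | d.sign = ε ∧ p d} =
        (D.finite.toFinset.filter fun d => d.sign = ε ∧ p d : Finset Chord) := by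
      ext d; simp
    rw [this, Set.ncard_coe_finset, Finset.card_filter]
    push_cast
    rfl
  unfold index rightCount leftCount
  rw [key, key, key, key, ← Finset.sum_sub_distrib, ← Finset.sum_add_distrib,
    ← Finset.sum_sub_distrib]
  refine Finset.sum_congr rfl fun d _ => ?_
  have h1 : ¬ ((1 : ℤˣ) = -1) := by decide
  have h2 : ¬ ((-1 : ℤˣ) = 1) := by decide
  rcases Int.units_eq_one_or d.sign with h | h <;> simp only [h, h1, h2, true_and, false_and,
    if_false, Units.val_one, Units.val_neg] <;> split_ifs <;> norm_num

/-- A chord `d ≠ c` changes the potential between the ends of `c` exactly when it crosses `c`, with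
the sign recorded by the index. -/
theorem index_eq_potential {D : GaussDiagram} {c : Chord} (hc : c ∈ D.chords) :
    D.index c = D.potential c.tail - D.potential c.head - c.sign := by
  classical
  have hs : (c.sign : ℤ) = ∑ d ∈ D.finite.toFinset, if d = c then (d.sign : ℤ) else 0 := by
    rw [Finset.sum_ite_eq' (D.finite.toFinset) c (fun d => (d.sign : ℤ))]
    simp [hc]
  rw [index_eq_sum, hs]
  unfold potential
  rw [← Finset.sum_sub_distrib, ← Finset.sum_sub_distrib]
  refine Finset.sum_congr rfl fun d hd => ?_
  have hd : d ∈ D.chords := by simpa using hd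
  have e1 := circleRep_injective.ne (D.tail_ne_head c hc c hc)
  have e2 := circleRep_injective.ne (D.tail_ne_head c hc d hd)
  have e3 := circleRep_injective.ne (D.tail_ne_head d hd c hc)
  simp only [Set.mem_cIoo, sbtw_iff_circleRep]
  unfold arcStep
  -- The chord `c` itself does not enter the index, but its own step drops by one from tail to head;
  -- this is the subtracted sign.
  by_cases hdc : d = c
  · subst hdc
    rw [if_pos rfl, ← sub_eq_zero]
    split_ifs <;> grind
  · rw [if_neg hdc, sub_zero, ← mul_sub]
    congr 1
    have e5 := circleRep_injective.ne (fun h => hdc (D.tail_injOn hd hc h))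
    have e6 := circleRep_injective.ne (fun h => hdc (D.head_injOn hd hc h))
    generalize circleRep c.tail = ct at *
    generalize circleRep c.head = ch at *
    generalize circleRep d.tail = dt at *
    generalize circleRep d.head = dh at *
    rcases lt_or_gt_of_ne e1 with f1 | f1 <;> rcases lt_or_gt_of_ne e2 with f2 | f2 <;>
    rcases lt_or_gt_of_ne e3 with f3 | f3 <;> rcases lt_or_gt_of_ne e5 with f5 | f5 <;>
    rcases lt_or_gt_of_ne e6 with f6 | f6 <;>
    first
      | (exfalso; linarith)
      | simp [f1, f2, f3, f5, f6, f1.not_gt, f2.not_gt, f3.not_gt, f5.not_gt, f6.not_gt, f2.le,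
          f3.le, f5.le, f6.le, f2.not_ge, f3.not_ge, f5.not_ge, f6.not_ge]

/-- Every endpoint that is not the smallest one follows a smaller one. -/
theorem exists_next_of_lt {D : GaussDiagram} {x y : UnitAddCircle} (hx : x ∈ D.endpoints)
    (hy : y ∈ D.endpoints) (hxy : circleRep x < circleRep y) :
    ∃ p, D.Next p y ∧ circleRep p < circleRep y := by
  obtain ⟨p, ⟨hp, hpy⟩, hmax⟩ := Set.exists_max_image {z ∈ D.endpoints | circleRep z < circleRep y}
    circleRep (D.endpoints_finite.subset fun z hz => hz.1) ⟨x, hx, hxy⟩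
  refine ⟨p, ⟨hp, hy, fun h => hpy.ne (by rw [h]), fun z hz hzE => ?_⟩, hpy⟩
  rw [Set.mem_cIoo, sbtw_iff_circleRep] at hz
  have := hmax z
  grind

theorem exists_next {D : GaussDiagram} {y : UnitAddCircle} (hy : y ∈ D.endpoints) :
    ∃ p, D.Next p y := by
  by_cases h : ∃ x ∈ D.endpoints, circleRep x < circleRep y
  · obtain ⟨x, hx, hxy⟩ := h
    obtain ⟨p, hp, -⟩ := exists_next_of_lt hx hy hxy
    exact ⟨p, hp⟩
  · push Not at h
    obtain ⟨p, hp, hmax⟩ := Set.exists_max_image D.endpoints circleRep D.endpoints_finite ⟨y, hy⟩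
    -- Here `y` has the smallest representative and its predecessor is the largest endpoint. They
    -- differ because a chord has two distinct ends.
    have hne : p ≠ y := by
      rintro rfl
      have hall : ∀ z ∈ D.endpoints, z = p := fun z hz =>
        circleRep_injective (le_antisymm (hmax z hz) (h z hz))
      obtain ⟨c, hc, -⟩ := hp
      exact D.tail_ne_head c hc c hc
        ((hall _ (tail_mem_endpoints hc)).trans (hall _ (head_mem_endpoints hc)).symm)
    refine ⟨p, hp, hy, hne, fun z hz hzE => ?_⟩
    rw [Set.mem_cIoo, sbtw_iff_circleRep] at hz
    have h1 := hmax z hzE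
    have h2 := h z hzE
    have h3 := hmax y hy
    grind

/-- A function that is constant along short arcs is constant on the endpoints. -/
theorem eq_of_forall_next {D : GaussDiagram} {α : Type*} {f : UnitAddCircle → α}
    (hf : ∀ x y, D.Next x y → f x = f y) {x y : UnitAddCircle} (hx : x ∈ D.endpoints)
    (hy : y ∈ D.endpoints) : f x = f y := by
  obtain ⟨m, hm, hmin⟩ := Set.exists_min_image D.endpoints circleRep D.endpoints_finite ⟨x, hx⟩
  -- Every endpoint is compared with the one nearest the cut, by induction on the number of
  -- endpoints before it.
  suffices h : ∀ n : ℕ, ∀ z ∈ D.endpoints,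
      {w ∈ D.endpoints | circleRep w < circleRep z}.ncard = n → f z = f m from
    (h _ x hx rfl).trans (h _ y hy rfl).symm
  intro n
  induction n using Nat.strong_induction_on with
  | _ n ih =>
    rintro z hz rfl
    rcases (hmin z hz).eq_or_lt with h | h
    · rw [circleRep_injective h]
    · obtain ⟨p, hp, hpz⟩ := exists_next_of_lt hm hz h
      rw [← hf p z hp]
      refine ih _ (Set.ncard_lt_ncard ?_
        (D.endpoints_finite.subset (Set.sep_subset _ _))) p hp.1 rfl
      refine (Set.ssubset_iff_of_subset fun w (hw : w ∈ {w ∈ D.endpoints | circleRep w < circleRep p}) =>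
        (⟨hw.1, hw.2.trans hpz⟩ : w ∈ {w ∈ D.endpoints | circleRep w < circleRep z})).2
        ⟨p, ⟨hp.1, hpz⟩, fun h : p ∈ {w ∈ D.endpoints | circleRep w < circleRep p} =>
          lt_irrefl _ h.2⟩

/-- The numbering axioms force the jumps of the potential. Conversely the potential has the right
jumps, and its remaining requirement, equal values just before the head and at the tail, says that
the index is zero. -/
theorem isAlmostClassical_iff {D : GaussDiagram} :
    D.IsAlmostClassical ↔ ∀ c ∈ D.chords, D.index c = 0 := by
  constructor
  · rintro ⟨lam, hlam⟩ c hc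
    have hstep : ∀ x y, D.Next x y → lam x - D.potential x = lam y - D.potential y := by
      intro x y hxy
      rw [hxy.potential_eq]
      obtain ⟨d, hd, rfl | rfl⟩ := hxy.2.1
      · obtain ⟨p', hp'⟩ := exists_next (head_mem_endpoints hd)
        rw [jump_tail hd, (hlam d hd x p' hxy hp').1]
        ring
      · obtain ⟨p, hp⟩ := exists_next (tail_mem_endpoints hd)
        obtain ⟨h1, h2, h3⟩ := hlam d hd p x hp hxy
        rw [jump_head hd, h3, h2, h1]
        ring
    have h := eq_of_forall_next (f := fun x => lam x - D.potential x) hstep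
      (tail_mem_endpoints hc) (head_mem_endpoints hc)
    obtain ⟨p, hp⟩ := exists_next (tail_mem_endpoints hc)
    obtain ⟨p', hp'⟩ := exists_next (head_mem_endpoints hc)
    obtain ⟨h1, h2, h3⟩ := hlam c hc p p' hp hp'
    rw [index_eq_potential hc]
    linarith
  · intro h
    refine ⟨D.potential, fun c hc p p' hp hp' => ?_⟩
    have h0 := h c hc
    rw [index_eq_potential hc] at h0
    have h1 := hp.potential_eq
    have h2 := hp'.potential_eq
    rw [jump_tail hc] at h1
    rw [jump_head hc] at h2
    refine ⟨h1, by linarith, by linarith⟩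

/-! ### The even part of a Gauss diagram -/

/-- The Gauss diagram in which only the chords of index zero are kept. -/
def evenPart (D : GaussDiagram) : GaussDiagram where
  chords := {c ∈ D.chords | D.index c = 0}
  finite := D.finite.subset (Set.sep_subset _ _)
  tail_injOn := D.tail_injOn.mono (Set.sep_subset _ _)
  head_injOn := D.head_injOn.mono (Set.sep_subset _ _)
  tail_ne_head := fun c hc d hd => D.tail_ne_head c hc.1 d hd.1

theorem endpoints_mono {D F : GaussDiagram} (h : F.chords ⊆ D.chords) :
    F.endpoints ⊆ D.endpoints := fun _ ⟨c, hc, hx⟩ => ⟨c, h hc, hx⟩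

theorem evenPart_chords_subset (D : GaussDiagram) : D.evenPart.chords ⊆ D.chords :=
  Set.sep_subset _ _

theorem evenPart_eq_self {D : GaussDiagram} (h : D.IsAlmostClassical) : D.evenPart = D :=
  GaussDiagram.ext (Set.sep_eq_self_iff_mem_true.2 (isAlmostClassical_iff.1 h))

theorem notMem_evenPart_endpoints {D : GaussDiagram} {c : Chord} (hc : c ∈ D.chords)
    (h : D.index c ≠ 0) : c.tail ∉ D.evenPart.endpoints ∧ c.head ∉ D.evenPart.endpoints := by
  constructor
  · rintro ⟨d, hd, h1 | h1⟩
    · rw [D.tail_injOn hd.1 hc h1] at hd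
      exact h hd.2
    · exact D.tail_ne_head c hc d hd.1 h1.symm
  · rintro ⟨d, hd, h1 | h1⟩
    · exact D.tail_ne_head d hd.1 c hc h1
    · rw [D.head_injOn hd.1 hc h1] at hd
      exact h hd.2

theorem Next.mono {D F : GaussDiagram} {x y : UnitAddCircle} (h : D.Next x y)
    (hF : F.chords ⊆ D.chords) (hx : x ∈ F.endpoints) (hy : y ∈ F.endpoints) : F.Next x y :=
  ⟨hx, hy, h.2.2.1, fun z hz hzF => h.2.2.2 z hz (endpoints_mono hF hzF)⟩

theorem Adjacent.mono {D F : GaussDiagram} {x y : UnitAddCircle} (h : D.Adjacent x y)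
    (hF : F.chords ⊆ D.chords) (hx : x ∈ F.endpoints) (hy : y ∈ F.endpoints) : F.Adjacent x y :=
  h.imp (fun h => h.mono hF hx hy) (fun h => h.mono hF hy hx)

theorem InOrder.mono {D F : GaussDiagram} {σ : ℤˣ} {x y : UnitAddCircle} (h : D.InOrder σ x y)
    (hF : F.chords ⊆ D.chords) (hx : x ∈ F.endpoints) (hy : y ∈ F.endpoints) : F.InOrder σ x y :=
  h.imp (fun h => ⟨h.1, h.2.mono hF hx hy⟩) (fun h => ⟨h.1, h.2.mono hF hy hx⟩)

theorem InOrder.adjacent {D : GaussDiagram} {σ : ℤˣ} {x y : UnitAddCircle}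
    (h : D.InOrder σ x y) : D.Adjacent x y := h.imp And.right And.right

theorem Adjacent.symm {D : GaussDiagram} {x y : UnitAddCircle} (h : D.Adjacent x y) :
    D.Adjacent y x := Or.symm h

theorem Adjacent.ne {D : GaussDiagram} {x y : UnitAddCircle} (h : D.Adjacent x y) : x ≠ y :=
  h.elim (fun h => h.2.2.1) (fun h => h.2.2.1.symm)

theorem Adjacent.left_mem {D : GaussDiagram} {x y : UnitAddCircle} (h : D.Adjacent x y) :
    x ∈ D.endpoints := h.elim (fun h => h.1) (fun h => h.2.1)

theorem Adjacent.right_mem {D : GaussDiagram} {x y : UnitAddCircle} (h : D.Adjacent x y) :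
    y ∈ D.endpoints := h.symm.left_mem

theorem arcStep_swap (p p' x : UnitAddCircle) : arcStep p' p x = -arcStep p p' x := by
  unfold arcStep; ring

/-- No other endpoint lies on the short arc. Changes made across such arcs therefore shift the
potential by one common constant at all uninvolved endpoints. -/
theorem Adjacent.arcStep_eq {D : GaussDiagram} {p p' : UnitAddCircle} (h : D.Adjacent p p') :
    ∃ k : ℤ, ∀ x ∈ D.endpoints, x ≠ p → x ≠ p' → arcStep p p' x = k := by
  rcases h with h | h
  · obtain ⟨k, hk⟩ := h.arcStep_eq
    exact ⟨k, fun x hx h1 h2 => by rw [hk x hx, if_neg h1, add_zero]⟩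
  · obtain ⟨k, hk⟩ := h.arcStep_eq
    exact ⟨-k, fun x hx h1 h2 => by rw [arcStep_swap, hk x hx, if_neg h2, add_zero]⟩

theorem potential_eq_sum {D : GaussDiagram} {s : Finset Chord} (h : D.chords = s)
    (x : UnitAddCircle) : D.potential x = ∑ c ∈ s, (c.sign : ℤ) * arcStep c.tail c.head x := by
  have : D.finite.toFinset = s := by
    apply Finset.coe_injective
    rw [Set.Finite.coe_toFinset, h]
  rw [potential, this]

/-- The index sees only differences of the potential, so a common shift is harmless. -/
theorem index_eq_of_potential {D D' : GaussDiagram} {k : ℤ} {c : Chord} (hc : c ∈ D.chords)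
    (hc' : c ∈ D'.chords) (ht : D'.potential c.tail = D.potential c.tail + k)
    (hh : D'.potential c.head = D.potential c.head + k) : D'.index c = D.index c := by
  rw [index_eq_potential hc, index_eq_potential hc', ht, hh]
  ring

/-! ### Moves that add chords -/

theorem index_eq_zero_of_adjacent {D : GaussDiagram} {c : Chord} (hc : c ∈ D.chords)
    (h : D.Adjacent c.tail c.head) : D.index c = 0 := by
  rw [index_eq_potential hc]
  rcases h with h | h
  · rw [h.potential_eq, jump_head hc]; ring
  · rw [h.potential_eq, jump_tail hc]; ring

theorem potential_insert {D D' : GaussDiagram} {c : Chord} (new : c ∉ D.chords)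
    (h : D'.chords = insert c D.chords) (x : UnitAddCircle) :
    D'.potential x = c.sign * arcStep c.tail c.head x + D.potential x := by
  classical
  rw [potential_eq_sum (s := insert c D.finite.toFinset) (by simp [h]),
    Finset.sum_insert (by simpa using new)]
  rfl

theorem endpoint_ne {D : GaussDiagram} {c d : Chord} (hc : c ∈ D.chords) (hd : d ∈ D.chords)
    (hne : d ≠ c) {x : UnitAddCircle} (hx : d.tail = x ∨ d.head = x) : x ≠ c.tail ∧ x ≠ c.head := by
  rcases hx with rfl | rfl
  · exact ⟨fun h => hne (D.tail_injOn hd hc h), D.tail_ne_head d hd c hc⟩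
  · exact ⟨(D.tail_ne_head c hc d hd).symm, fun h => hne (D.head_injOn hd hc h)⟩

theorem index_insert_of_adjacent {D D' : GaussDiagram} {c : Chord} (new : c ∉ D.chords)
    (h : D'.chords = insert c D.chords) (adj : D'.Adjacent c.tail c.head) {d : Chord}
    (hd : d ∈ D.chords) : D'.index d = D.index d := by
  obtain ⟨k, hk⟩ := adj.arcStep_eq
  have hc' : c ∈ D'.chords := h ▸ Set.mem_insert _ _
  have hd' : d ∈ D'.chords := h ▸ Set.mem_insert_of_mem _ hd
  have hne : d ≠ c := fun e => new (e ▸ hd)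
  have key : ∀ x, (d.tail = x ∨ d.head = x) → D'.potential x = D.potential x + c.sign * k := by
    intro x hx
    obtain ⟨h1, h2⟩ := endpoint_ne hc' hd' hne hx
    rw [potential_insert new h, hk x ⟨d, hd', hx⟩ h1 h2]
    ring
  exact index_eq_of_potential hd hd' (key _ (Or.inl rfl)) (key _ (Or.inr rfl))

/-- The isolated chord is even and alters no other index, so the move survives deletion of the odd
chords. -/
theorem evenPart_r1 {D D' : GaussDiagram} {c : Chord} (new : c ∉ D.chords)
    (h : D'.chords = insert c D.chords) (adj : D'.Adjacent c.tail c.head) :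
    Move D.evenPart D'.evenPart := by
  have hc' : c ∈ D'.chords := h ▸ Set.mem_insert _ _
  have hc0 := index_eq_zero_of_adjacent hc' adj
  have hce : c ∈ D'.evenPart.chords := ⟨hc', hc0⟩
  refine Move.r1 _ _ c (fun h => new h.1) ?_
    (adj.mono D'.evenPart_chords_subset (tail_mem_endpoints hce) (head_mem_endpoints hce))
  ext d
  change d ∈ D'.chords ∧ D'.index d = 0 ↔ d = c ∨ d ∈ D.chords ∧ D.index d = 0
  by_cases hd : d ∈ D.chords
  · rw [index_insert_of_adjacent new h adj hd, h, Set.mem_insert_iff]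
    have hne : d ≠ c := fun e => new (e ▸ hd)
    tauto
  · rw [h, Set.mem_insert_iff]
    constructor
    · rintro ⟨h1, -⟩; tauto
    · rintro (rfl | h1)
      · exact ⟨Or.inl rfl, hc0⟩
      · exact absurd h1.1 hd

/-- Since the signs are opposite, passing from `c` to `d` lowers the potential at the tail and
raises it at the head by the sign of `c`, in either order of the strands. The change of the sign
term compensates. -/
theorem index_eq_of_adjacent {D : GaussDiagram} {c d : Chord} (hc : c ∈ D.chords)
    (hd : d ∈ D.chords) (opposite : d.sign = -c.sign) (adj_tail : D.Adjacent c.tail d.tail)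
    (adj_head : D.Adjacent c.head d.head) : D.index c = D.index d := by
  have hs : (d.sign : ℤ) = -c.sign := by rw [opposite]; simp
  have j1 := jump_tail hc
  have j2 := jump_tail hd
  have j3 := jump_head hc
  have j4 := jump_head hd
  rw [index_eq_potential hc, index_eq_potential hd]
  rcases adj_tail with h | h <;> rcases adj_head with h' | h' <;>
    linarith [h.potential_eq, h'.potential_eq]

theorem index_insert_pair {D D' : GaussDiagram} {c d : Chord} (newc : c ∉ D.chords)
    (newd : d ∉ D.chords) (h : D'.chords = insert c (insert d D.chords))
    (opposite : d.sign = -c.sign) (adj_tail : D'.Adjacent c.tail d.tail)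
    (adj_head : D'.Adjacent c.head d.head) {e : Chord} (he : e ∈ D.chords) :
    D'.index e = D.index e := by
  classical
  obtain ⟨k, hk⟩ := adj_tail.arcStep_eq
  obtain ⟨l, hl⟩ := adj_head.arcStep_eq
  have hc' : c ∈ D'.chords := h ▸ Set.mem_insert _ _
  have hd' : d ∈ D'.chords := h ▸ Set.mem_insert_of_mem _ (Set.mem_insert _ _)
  have he' : e ∈ D'.chords := h ▸ Set.mem_insert_of_mem _ (Set.mem_insert_of_mem _ he)
  have hs : (d.sign : ℤ) = -c.sign := by rw [opposite]; simp
  have hcd : c ≠ d := fun e => adj_tail.ne (by rw [e])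
  have key : ∀ x, (e.tail = x ∨ e.head = x) →
      D'.potential x = D.potential x + c.sign * (k - l) := by
    intro x hx
    obtain ⟨h1, h2⟩ := endpoint_ne hc' he' (fun e => newc (e ▸ he)) hx
    obtain ⟨h3, h4⟩ := endpoint_ne hd' he' (fun e => newd (e ▸ he)) hx
    have hxE : x ∈ D'.endpoints := ⟨e, he', hx⟩
    -- With opposite signs, the tail-to-head steps of `c` and `d` regroup into a tail-to-tail step
    -- minus a head-to-head step, both constant here.
    rw [potential_eq_sum (s := insert c (insert d D.finite.toFinset)) (by simp [h]),
      Finset.sum_insert (by simpa [hcd] using newc), Finset.sum_insert (by simpa using newd),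
      ← hk x hxE h1 h3, ← hl x hxE h2 h4, hs]
    unfold potential arcStep
    ring
  exact index_eq_of_potential he he' (key _ (Or.inl rfl)) (key _ (Or.inr rfl))

/-- The two new chords have equal index: both stay, giving the same kind of move, or both disappear,
giving equal diagrams. -/
theorem evenPart_r2 {D D' : GaussDiagram} {c d : Chord} (newc : c ∉ D.chords)
    (newd : d ∉ D.chords) (h : D'.chords = insert c (insert d D.chords))
    (opposite : d.sign = -c.sign) (adj_tail : D'.Adjacent c.tail d.tail)
    (adj_head : D'.Adjacent c.head d.head) : Equivalent D.evenPart D'.evenPart := by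
  have hc' : c ∈ D'.chords := h ▸ Set.mem_insert _ _
  have hd' : d ∈ D'.chords := h ▸ Set.mem_insert_of_mem _ (Set.mem_insert _ _)
  have hcd := index_eq_of_adjacent hc' hd' opposite adj_tail adj_head
  have hind := fun e he => index_insert_pair newc newd h opposite adj_tail adj_head (e := e) he
  have hmem : ∀ e, e ∈ D'.evenPart.chords ↔
      (e = c ∧ D'.index c = 0) ∨ (e = d ∧ D'.index d = 0) ∨ e ∈ D.evenPart.chords := by
    intro e
    change e ∈ D'.chords ∧ D'.index e = 0 ↔ _ ∨ _ ∨ e ∈ D.chords ∧ D.index e = 0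
    rw [h, Set.mem_insert_iff, Set.mem_insert_iff]
    by_cases he : e ∈ D.chords
    · rw [hind e he]
      have h1 : e ≠ c := fun h => newc (h ▸ he)
      have h2 : e ≠ d := fun h => newd (h ▸ he)
      tauto
    · constructor
      · rintro ⟨rfl | rfl | h1, h2⟩ <;> tauto
      · rintro (⟨rfl, h1⟩ | ⟨rfl, h1⟩ | h1) <;> tauto
  by_cases h0 : D'.index c = 0
  · have hce : c ∈ D'.evenPart.chords := ⟨hc', h0⟩
    have hde : d ∈ D'.evenPart.chords := ⟨hd', hcd ▸ h0⟩
    refine Relation.EqvGen.rel _ _ (Move.r2 _ _ c d (fun h => newc h.1) (fun h => newd h.1) ?_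
      opposite
      (adj_tail.mono D'.evenPart_chords_subset (tail_mem_endpoints hce) (tail_mem_endpoints hde))
      (adj_head.mono D'.evenPart_chords_subset (head_mem_endpoints hce) (head_mem_endpoints hde)))
    ext e
    rw [hmem, ← hcd, Set.mem_insert_iff, Set.mem_insert_iff]
    tauto
  · have : D.evenPart = D'.evenPart := by
      apply GaussDiagram.ext
      ext e
      rw [hmem, ← hcd]
      tauto
    rw [this]
    exact Relation.EqvGen.refl _

/-! ### Isotopies -/

theorem index_isotopy {D D' : GaussDiagram} {f : UnitAddCircle → UnitAddCircle}
    (inj : Set.InjOn f D.endpoints)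
    (orientation : ∀ x ∈ D.endpoints, ∀ y ∈ D.endpoints, ∀ z ∈ D.endpoints,
      (sbtw (f x) (f y) (f z) ↔ sbtw x y z))
    (chords_eq : D'.chords = Chord.map f '' D.chords) {c : Chord} (hc : c ∈ D.chords) :
    D'.index (c.map f) = D.index c := by
  have hmap : Set.InjOn (Chord.map f) D.chords := by
    intro d hd e he h
    have h1 : f d.tail = f e.tail := congrArg Chord.tail h
    exact D.tail_injOn hd he (inj (tail_mem_endpoints hd) (tail_mem_endpoints he) h1)
  have key : ∀ p p' : Chord → Prop, (∀ d ∈ D.chords, (p' (d.map f) ↔ p d)) →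
      {d ∈ D'.chords | p' d}.ncard = {d ∈ D.chords | p d}.ncard := by
    intro p p' hp
    rw [← Set.InjOn.ncard_image (f := Chord.map f) (s := {d ∈ D.chords | p d})
      (hmap.mono (Set.sep_subset _ _))]
    congr 1
    ext e
    rw [chords_eq]
    constructor
    · rintro ⟨⟨d, hd, rfl⟩, h⟩
      exact ⟨d, ⟨hd, (hp d hd).1 h⟩, rfl⟩
    · rintro ⟨d, ⟨hd, h⟩, rfl⟩
      exact ⟨⟨d, hd, rfl⟩, (hp d hd).2 h⟩
  have ht := tail_mem_endpoints hc
  have hh := head_mem_endpoints hc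
  have hr : ∀ ε, D'.rightCount (c.map f) ε = D.rightCount c ε := fun ε => key _ _ fun d hd => by
    have ht' := tail_mem_endpoints hd
    have hh' := head_mem_endpoints hd
    simp only [Chord.map, Set.mem_cIoo, orientation _ ht _ hh' _ hh, orientation _ hh _ ht' _ ht]
  have hl : ∀ ε, D'.leftCount (c.map f) ε = D.leftCount c ε := fun ε => key _ _ fun d hd => by
    have ht' := tail_mem_endpoints hd
    have hh' := head_mem_endpoints hd
    simp only [Chord.map, Set.mem_cIoo, orientation _ ht _ ht' _ hh, orientation _ hh _ hh' _ ht]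
  rw [index, index, hr, hr, hl, hl]

theorem evenPart_isotopy {D D' : GaussDiagram} {f : UnitAddCircle → UnitAddCircle}
    (inj : Set.InjOn f D.endpoints)
    (orientation : ∀ x ∈ D.endpoints, ∀ y ∈ D.endpoints, ∀ z ∈ D.endpoints,
      (sbtw (f x) (f y) (f z) ↔ sbtw x y z))
    (chords_eq : D'.chords = Chord.map f '' D.chords) : Move D.evenPart D'.evenPart := by
  have hsub := endpoints_mono D.evenPart_chords_subset
  refine Move.isotopy _ _ f (inj.mono hsub) (fun x hx y hy z hz =>
    orientation x (hsub hx) y (hsub hy) z (hsub hz)) ?_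
  ext e
  change e ∈ D'.chords ∧ D'.index e = 0 ↔ _
  rw [chords_eq]
  constructor
  · rintro ⟨⟨d, hd, rfl⟩, h⟩
    exact ⟨d, ⟨hd, by rwa [index_isotopy inj orientation chords_eq hd] at h⟩, rfl⟩
  · rintro ⟨d, ⟨hd, h⟩, rfl⟩
    exact ⟨⟨d, hd, rfl⟩, by rwa [index_isotopy inj orientation chords_eq hd]⟩

/-- Exchanging two adjacent endpoints preserves the cyclic order of three endpoints that do not
include both. -/
theorem Adjacent.sbtw_swap {D : GaussDiagram} {p p' : UnitAddCircle} (h : D.Adjacent p p')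
    {x y z : UnitAddCircle} (hx : x ∈ D.endpoints) (hy : y ∈ D.endpoints) (hz : z ∈ D.endpoints)
    (hnot : (x ≠ p ∧ y ≠ p ∧ z ≠ p) ∨ (x ≠ p' ∧ y ≠ p' ∧ z ≠ p')) :
    sbtw (Equiv.swap p p' x) (Equiv.swap p p' y) (Equiv.swap p p' z) ↔ sbtw x y z := by
  wlog hn : D.Next p p' generalizing p p'
  · rw [Equiv.swap_comm]
    exact this h.symm hnot.symm (h.resolve_left hn)
  -- Neither `w` nor `v` lies between `p` and `p'`, so these two are interchangeable relative to
  -- them.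
  have h1 : ∀ w v, w ∈ D.endpoints → v ∈ D.endpoints → w ≠ p → w ≠ p' → v ≠ p → v ≠ p' →
      (sbtw p w v ↔ sbtw p' w v) := by
    intro w v hw hv e1 e2 e3 e4
    have hw' : ¬ sbtw p w p' := fun h => hn.2.2.2 w h hw
    have hv' : ¬ sbtw p v p' := fun h => hn.2.2.2 v h hv
    rw [sbtw_iff_circleRep] at hw' hv' ⊢
    rw [sbtw_iff_circleRep]
    have e5 := hn.2.2.1
    rw [← circleRep_injective.ne_iff] at e1 e2 e3 e4 e5
    grind
  have h2 : ∀ w v, w ∈ D.endpoints → v ∈ D.endpoints → w ≠ p → w ≠ p' → v ≠ p → v ≠ p' →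
      (sbtw w p v ↔ sbtw w p' v) := fun w v hw hv e1 e2 e3 e4 => by
    rw [← sbtw_cyclic (c := w), ← sbtw_cyclic (c := w), h1 v w hv hw e3 e4 e1 e2]
  have h3 : ∀ w v, w ∈ D.endpoints → v ∈ D.endpoints → w ≠ p → w ≠ p' → v ≠ p → v ≠ p' →
      (sbtw w v p ↔ sbtw w v p') := fun w v hw hv e1 e2 e3 e4 => by
    rw [sbtw_cyclic (a := w), sbtw_cyclic (a := w), h1 w v hw hv e1 e2 e3 e4]
  have f1 : ∀ a b : UnitAddCircle, ¬ sbtw a a b := fun a b h => by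
    rw [sbtw_iff_circleRep] at h; grind
  have f2 : ∀ a b : UnitAddCircle, ¬ sbtw a b a := fun a b h => by
    rw [sbtw_iff_circleRep] at h; grind
  have f3 : ∀ a b : UnitAddCircle, ¬ sbtw a b b := fun a b h => by
    rw [sbtw_iff_circleRep] at h; grind
  simp only [Equiv.swap_apply_def]
  have hne := hn.2.2.1
  split_ifs <;> grind

/-- Moving the ends of a chord past adjacent endpoints of a larger diagram is an isotopy. -/
theorem move_of_adjacent {G F F' : GaussDiagram} {S : Set Chord} {p p' r r' : UnitAddCircle}
    {s : ℤˣ} (hFG : F.chords ⊆ G.chords) (hF : F.chords = S ∪ {⟨p, r, s⟩})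
    (hF' : F'.chords = S ∪ {⟨p', r', s⟩}) (hS : (⟨p, r, s⟩ : Chord) ∉ S)
    (hp : G.Adjacent p p') (hr : G.Adjacent r r') (hp' : p' ∉ F.endpoints)
    (hr' : r' ∉ F.endpoints) : Move F F' := by
  have hc : (⟨p, r, s⟩ : Chord) ∈ F.chords := hF ▸ Or.inr rfl
  have hc' : (⟨p', r', s⟩ : Chord) ∈ F'.chords := hF' ▸ Or.inr rfl
  have hpF : p ∈ F.endpoints := tail_mem_endpoints hc
  have hrF : r ∈ F.endpoints := head_mem_endpoints hc
  have hpr : p ≠ r := F.tail_ne_head _ hc _ hc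
  have hpr' : p' ≠ r' := F'.tail_ne_head _ hc' _ hc'
  have hpr1 : p ≠ r' := fun h => hr' (h ▸ hpF)
  have hrp1 : r ≠ p' := fun h => hp' (h ▸ hrF)
  have hsub := endpoints_mono hFG
  have hswap : ∀ x ∈ F.endpoints, Equiv.swap p p' x ∈ G.endpoints := by
    intro x hx
    rw [Equiv.swap_apply_def]
    split_ifs
    · exact hp.right_mem
    · exact hp.left_mem
    · exact hsub hx
  have hswap' : ∀ x ∈ F.endpoints, Equiv.swap p p' x ≠ r' := by
    intro x hx
    rw [Equiv.swap_apply_def]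
    split_ifs
    · exact hpr'
    · exact hpr1
    · exact fun h => hr' (h ▸ hx)
  -- The tail moves first, then the head. Each transposition preserves cyclic order because its
  -- target is unoccupied at that stage.
  refine Move.isotopy _ _ (fun x => Equiv.swap r r' (Equiv.swap p p' x))
    (((Equiv.swap r r').injective.comp (Equiv.swap p p').injective).injOn) ?_ ?_
  · have hne : ∀ x ∈ F.endpoints, x ≠ p' := by
      rintro _ hx rfl
      exact hp' hx
    intro x hx y hy z hz
    rw [hr.sbtw_swap (hswap x hx) (hswap y hy) (hswap z hz)
        (Or.inr ⟨hswap' x hx, hswap' y hy, hswap' z hz⟩),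
      hp.sbtw_swap (hsub hx) (hsub hy) (hsub hz) (Or.inr ⟨hne x hx, hne y hy, hne z hz⟩)]
  · have hid : ∀ d ∈ S, Chord.map (fun x => Equiv.swap r r' (Equiv.swap p p' x)) d = d := by
      intro d hd
      have hdF : d ∈ F.chords := hF ▸ Or.inl hd
      have hdne : d ≠ ⟨p, r, s⟩ := fun h => hS (h ▸ hd)
      have hfix : ∀ x, (d.tail = x ∨ d.head = x) → Equiv.swap r r' (Equiv.swap p p' x) = x := by
        intro x hx
        obtain ⟨h1, h2⟩ := endpoint_ne hc hdF hdne hx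
        have hxF : x ∈ F.endpoints := ⟨d, hdF, hx⟩
        rw [Equiv.swap_apply_of_ne_of_ne h1 (ne_of_mem_of_not_mem hxF hp'),
          Equiv.swap_apply_of_ne_of_ne h2 (ne_of_mem_of_not_mem hxF hr')]
      exact Chord.ext (hfix _ (Or.inl rfl)) (hfix _ (Or.inr rfl)) rfl
    have hcm : Chord.map (fun x => Equiv.swap r r' (Equiv.swap p p' x)) ⟨p, r, s⟩ = ⟨p', r', s⟩ := by
      refine Chord.ext ?_ ?_ rfl
      · simp only [Chord.map, Equiv.swap_apply_left]
        exact Equiv.swap_apply_of_ne_of_ne hrp1.symm hpr'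
      · simp only [Chord.map]
        rw [Equiv.swap_apply_of_ne_of_ne hpr.symm hrp1, Equiv.swap_apply_left]
    rw [hF, hF', Set.image_union, Set.image_singleton, hcm]
    congr 1
    ext d
    exact ⟨fun hd => ⟨d, hd, hid d hd⟩, fun ⟨e, he, h⟩ => by rwa [← h, hid e he]⟩

/-! ### The third Reidemeister move -/

/-- The factors `1 + σ` and `1 - σ` are twice the indicators of the two orders. Doubling covers both
by one integral formula. -/
theorem InOrder.arcStep_eq {D : GaussDiagram} {σ : ℤˣ} {p p' : UnitAddCircle}
    (h : D.InOrder σ p p') : ∃ k : ℤ, ∀ x ∈ D.endpoints, 2 * arcStep p p' x =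
      2 * k + (1 + σ) * (if x = p then 1 else 0) - (1 - σ) * (if x = p' then 1 else 0) := by
  rcases h with ⟨rfl, h⟩ | ⟨rfl, h⟩
  · obtain ⟨k, hk⟩ := h.arcStep_eq
    refine ⟨k, fun x hx => ?_⟩
    rw [hk x hx]
    push_cast
    ring
  · obtain ⟨k, hk⟩ := h.arcStep_eq
    refine ⟨-k, fun x hx => ?_⟩
    rw [arcStep_swap, hk x hx]
    push_cast
    ring

theorem InOrder.potential_eq {D : GaussDiagram} {σ : ℤˣ} {p p' : UnitAddCircle}
    (h : D.InOrder σ p p') :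
    2 * D.potential p' = 2 * D.potential p + (1 + σ) * D.jump p' - (1 - σ) * D.jump p := by
  rcases h with ⟨rfl, h⟩ | ⟨rfl, h⟩
  · rw [h.potential_eq]
    push_cast
    ring
  · rw [h.potential_eq]
    push_cast
    ring

/-- The three chords taking part in a third Reidemeister move have distinct endpoints, which are
not endpoints of other chords. -/
theorem r3_endpoints {D D' : GaussDiagram} {S : Set Chord} {x₁ x₂ y₁ y₂ z₁ z₂ : UnitAddCircle}
    {a b c : ℤˣ} (h : D.chords = S ∪ {⟨x₁, y₁, a⟩, ⟨x₂, z₁, b⟩, ⟨y₂, z₂, c⟩})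
    (h' : D'.chords = S ∪ {⟨x₂, y₂, a⟩, ⟨x₁, z₂, b⟩, ⟨y₁, z₁, c⟩})
    (hx : x₁ ≠ x₂) (hy : y₁ ≠ y₂) (hz : z₁ ≠ z₂) :
    [x₁, x₂, y₁, y₂, z₁, z₂].Nodup ∧
      ∀ d ∈ S, ∀ x, d.tail = x ∨ d.head = x → x ∉ [x₁, x₂, y₁, y₂, z₁, z₂] := by
  have m1 : (⟨x₁, y₁, a⟩ : Chord) ∈ D.chords := by simp [h]
  have m2 : (⟨x₂, z₁, b⟩ : Chord) ∈ D.chords := by simp [h]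
  have m3 : (⟨y₂, z₂, c⟩ : Chord) ∈ D.chords := by simp [h]
  have m1' : (⟨x₂, y₂, a⟩ : Chord) ∈ D'.chords := by simp [h']
  have m2' : (⟨x₁, z₂, b⟩ : Chord) ∈ D'.chords := by simp [h']
  have m3' : (⟨y₁, z₁, c⟩ : Chord) ∈ D'.chords := by simp [h']
  have e1 := D.tail_ne_head _ m1 _ m1
  have e2 := D.tail_ne_head _ m1 _ m2
  have e3 := D.tail_ne_head _ m1 _ m3
  have e4 := D.tail_ne_head _ m2 _ m1
  have e5 := D.tail_ne_head _ m2 _ m2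
  have e6 := D.tail_ne_head _ m2 _ m3
  have e7 := D.tail_ne_head _ m3 _ m2
  have e8 := D.tail_ne_head _ m3 _ m3
  have f1 := D'.tail_ne_head _ m1' _ m1'
  have f2 := D'.tail_ne_head _ m2' _ m1'
  have f3 := D'.tail_ne_head _ m3' _ m2'
  have f4 := D'.tail_ne_head _ m3' _ m3'
  simp only at e1 e2 e3 e4 e5 e6 e7 e8 f1 f2 f3 f4
  refine ⟨by simp [*], fun d hd x hdx => ?_⟩
  have hdD : d ∈ D.chords := h ▸ Or.inl hd
  have hdD' : d ∈ D'.chords := h' ▸ Or.inl hd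
  -- A chord of `S` lies in both diagrams. Were it one of the three chords of `D`, its tail would
  -- already be taken in `D'` by an end of a different chord.
  have n1 : d ≠ ⟨x₁, y₁, a⟩ := by
    rintro rfl
    exact f3 (congrArg Chord.head (D'.tail_injOn hdD' m2' rfl))
  have n2 : d ≠ ⟨x₂, z₁, b⟩ := by
    rintro rfl
    exact e7 (congrArg Chord.head (D'.tail_injOn hdD' m1' rfl)).symm
  have n3 : d ≠ ⟨y₂, z₂, c⟩ := by
    rintro rfl
    exact D'.tail_ne_head _ hdD' _ m1' rfl
  obtain ⟨g1, g2⟩ := endpoint_ne m1 hdD n1 hdx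
  obtain ⟨g3, g4⟩ := endpoint_ne m2 hdD n2 hdx
  obtain ⟨g5, g6⟩ := endpoint_ne m3 hdD n3 hdx
  simp only at g1 g2 g3 g4 g5 g6
  simp [*]

set_option maxHeartbeats 1000000 in
/-- The indices of the chords before and after a third Reidemeister move. -/
theorem r3_index {D D' : GaussDiagram} {S : Set Chord} {x₁ x₂ y₁ y₂ z₁ z₂ : UnitAddCircle}
    {a b c δ : ℤˣ} (h : D.chords = S ∪ {⟨x₁, y₁, a⟩, ⟨x₂, z₁, b⟩, ⟨y₂, z₂, c⟩})
    (h' : D'.chords = S ∪ {⟨x₂, y₂, a⟩, ⟨x₁, z₂, b⟩, ⟨y₁, z₁, c⟩})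
    (top : D.InOrder (δ * (a * b * c)) x₁ x₂) (middle : D.InOrder (δ * a) y₁ y₂)
    (bottom : D.InOrder (δ * b) z₁ z₂) :
    (∀ d ∈ S, D'.index d = D.index d) ∧
      D'.index ⟨x₂, y₂, a⟩ = D.index ⟨x₁, y₁, a⟩ ∧
      D'.index ⟨x₁, z₂, b⟩ = D.index ⟨x₂, z₁, b⟩ ∧
      D'.index ⟨y₁, z₁, c⟩ = D.index ⟨y₂, z₂, c⟩ ∧
      D.index ⟨x₁, y₁, a⟩ - D.index ⟨x₂, z₁, b⟩ + D.index ⟨y₂, z₂, c⟩ = 0 := by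
  classical
  obtain ⟨hnodup, hS⟩ := r3_endpoints h h' top.adjacent.ne middle.adjacent.ne bottom.adjacent.ne
  have m1 : (⟨x₁, y₁, a⟩ : Chord) ∈ D.chords := by simp [h]
  have m2 : (⟨x₂, z₁, b⟩ : Chord) ∈ D.chords := by simp [h]
  have m3 : (⟨y₂, z₂, c⟩ : Chord) ∈ D.chords := by simp [h]
  have m1' : (⟨x₂, y₂, a⟩ : Chord) ∈ D'.chords := by simp [h']
  have m2' : (⟨x₁, z₂, b⟩ : Chord) ∈ D'.chords := by simp [h']
  have m3' : (⟨y₁, z₁, c⟩ : Chord) ∈ D'.chords := by simp [h']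
  have hfin : S.Finite := D.finite.subset (h ▸ Set.subset_union_left)
  have hne := hnodup
  simp only [List.nodup_cons, List.mem_cons, List.not_mem_nil, or_false, not_or, not_false_eq_true,
    List.nodup_nil, and_true] at hne
  have hSn : ∀ (p r : UnitAddCircle) (s : ℤˣ), p ∈ [x₁, x₂, y₁, y₂, z₁, z₂] →
      (⟨p, r, s⟩ : Chord) ∉ S := fun p r s hp hc => hS _ hc p (Or.inl rfl) hp
  have hV : ∀ x, D.potential x = a * arcStep x₁ y₁ x + (b * arcStep x₂ z₁ x +
      (c * arcStep y₂ z₂ x + ∑ d ∈ hfin.toFinset, (d.sign : ℤ) * arcStep d.tail d.head x)) := by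
    intro x
    rw [potential_eq_sum (s := insert ⟨x₁, y₁, a⟩ (insert ⟨x₂, z₁, b⟩
        (insert ⟨y₂, z₂, c⟩ hfin.toFinset))) (by simp [h, Set.union_comm S, Set.insert_union]),
      Finset.sum_insert, Finset.sum_insert, Finset.sum_insert]
    all_goals simp [hSn, hne]
  have hV' : ∀ x, D'.potential x = a * arcStep x₂ y₂ x + (b * arcStep x₁ z₂ x +
      (c * arcStep y₁ z₁ x + ∑ d ∈ hfin.toFinset, (d.sign : ℤ) * arcStep d.tail d.head x)) := by
    intro x
    rw [potential_eq_sum (s := insert ⟨x₂, y₂, a⟩ (insert ⟨x₁, z₂, b⟩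
        (insert ⟨y₁, z₁, c⟩ hfin.toFinset))) (by simp [h', Set.union_comm S, Set.insert_union]),
      Finset.sum_insert, Finset.sum_insert, Finset.sum_insert]
    all_goals simp [hSn, hne, Ne.symm hne.1.1]
  -- The move only exchanges ends along the three short arcs, so the potentials differ by steps
  -- across these arcs.
  have hVV : ∀ x, D'.potential x = D.potential x + (b - a) * arcStep x₁ x₂ x +
      (a + c) * arcStep y₁ y₂ x + (b - c) * arcStep z₁ z₂ x := by
    intro x
    rw [hV, hV']
    simp only [arcStep]
    ring
  obtain ⟨k, hk⟩ := top.arcStep_eq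
  obtain ⟨l, hl⟩ := middle.arcStep_eq
  obtain ⟨m, hm⟩ := bottom.arcStep_eq
  constructor
  · intro d hd
    have hdD : d ∈ D.chords := h ▸ Or.inl hd
    have key : ∀ x, (d.tail = x ∨ d.head = x) →
        D'.potential x = D.potential x + ((b - a) * k + (a + c) * l + (b - c) * m) := by
      intro x hx
      have hxE : x ∈ D.endpoints := ⟨d, hdD, hx⟩
      have hx' := hS d hd x hx
      simp only [List.mem_cons, List.not_mem_nil, or_false, not_or] at hx'
      have k1 := hk x hxE
      have l1 := hl x hxE
      have m1 := hm x hxE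
      simp only [hx', if_false, mul_zero, add_zero, sub_zero] at k1 l1 m1
      rw [hVV, show arcStep x₁ x₂ x = k by omega, show arcStep y₁ y₂ x = l by omega,
        show arcStep z₁ z₂ x = m by omega]
      ring
    exact index_eq_of_potential hdD (h' ▸ Or.inl hd) (key _ (Or.inl rfl)) (key _ (Or.inr rfl))
  · have t := top.potential_eq
    have u := middle.potential_eq
    have v := bottom.potential_eq
    have j1 : D.jump x₁ = a := jump_tail m1
    have j2 : D.jump x₂ = b := jump_tail m2
    have j3 : D.jump y₂ = c := jump_tail m3
    have j4 : D.jump y₁ = -a := jump_head m1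
    have j5 : D.jump z₁ = -b := jump_head m2
    have j6 : D.jump z₂ = -c := jump_head m3
    rw [j1, j2] at t
    rw [j3, j4] at u
    rw [j5, j6] at v
    rw [index_eq_potential m1, index_eq_potential m2, index_eq_potential m3,
      index_eq_potential m1', index_eq_potential m2', index_eq_potential m3']
    simp only [hVV]
    have q : ∀ x ∈ [x₁, x₂, y₁, y₂, z₁, z₂], x ∈ D.endpoints := by
      simp only [List.forall_mem_cons]
      exact ⟨tail_mem_endpoints m1, tail_mem_endpoints m2, head_mem_endpoints m1,
        tail_mem_endpoints m3, head_mem_endpoints m2, head_mem_endpoints m3, by simp⟩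
    simp only [List.forall_mem_cons] at q
    obtain ⟨q1, q2, q3, q4, q5, q6, -⟩ := q
    obtain ⟨⟨n1, n2, n3, n4, n5⟩, ⟨n6, n7, n8, n9⟩, ⟨n10, n11, n12⟩, ⟨n13, n14⟩, n15⟩ := hne
    have k1 := hk x₁ q1
    have k2 := hk x₂ q2
    have k3 := hk y₁ q3
    have k4 := hk y₂ q4
    have k5 := hk z₁ q5
    have k6 := hk z₂ q6
    have l1 := hl x₁ q1
    have l2 := hl x₂ q2
    have l3 := hl y₁ q3
    have l4 := hl y₂ q4
    have l5 := hl z₁ q5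
    have l6 := hl z₂ q6
    have m1 := hm x₁ q1
    have m2 := hm x₂ q2
    have m3 := hm y₁ q3
    have m4 := hm y₂ q4
    have m5 := hm z₁ q5
    have m6 := hm z₂ q6
    simp only [n1, n2, n3, n4, n5, n6, n7, n8, n9, n10, n11, n12, n13, n14, n15, Ne.symm n1,
      Ne.symm n2, Ne.symm n3, Ne.symm n4, Ne.symm n5, Ne.symm n6, Ne.symm n7, Ne.symm n8,
      Ne.symm n9, Ne.symm n10, Ne.symm n11, Ne.symm n12, Ne.symm n13, Ne.symm n14, Ne.symm n15,
      if_true, if_false, mul_one, mul_zero, add_zero, sub_zero, Units.val_mul]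
      at k1 k2 k3 k4 k5 k6 l1 l2 l3 l4 l5 l6 m1 m2 m3 m4 m5 m6 t u v
    have ua : (a : ℤ) = 1 ∨ (a : ℤ) = -1 := Int.isUnit_iff.1 a.isUnit
    have ub : (b : ℤ) = 1 ∨ (b : ℤ) = -1 := Int.isUnit_iff.1 b.isUnit
    have uc : (c : ℤ) = 1 ∨ (c : ℤ) = -1 := Int.isUnit_iff.1 c.isUnit
    have ud : (δ : ℤ) = 1 ∨ (δ : ℤ) = -1 := Int.isUnit_iff.1 δ.isUnit
    clear hV hV' hVV hk hl hm j1 j2 j3 j4 j5 j6 q1 q2 q3 q4 q5 q6 hS hSn hnodup h h'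
    generalize arcStep x₁ x₂ x₁ = A1 at *
    generalize arcStep x₁ x₂ x₂ = A2 at *
    generalize arcStep x₁ x₂ y₁ = A3 at *
    generalize arcStep x₁ x₂ y₂ = A4 at *
    generalize arcStep x₁ x₂ z₁ = A5 at *
    generalize arcStep x₁ x₂ z₂ = A6 at *
    generalize arcStep y₁ y₂ x₁ = A7 at *
    generalize arcStep y₁ y₂ x₂ = A8 at *
    generalize arcStep y₁ y₂ y₁ = A9 at *
    generalize arcStep y₁ y₂ y₂ = A10 at *
    generalize arcStep y₁ y₂ z₁ = A11 at *
    generalize arcStep y₁ y₂ z₂ = A12 at *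
    generalize arcStep z₁ z₂ x₁ = A13 at *
    generalize arcStep z₁ z₂ x₂ = A14 at *
    generalize arcStep z₁ z₂ y₁ = A15 at *
    generalize arcStep z₁ z₂ y₂ = A16 at *
    generalize arcStep z₁ z₂ z₁ = A17 at *
    generalize arcStep z₁ z₂ z₂ = A18 at *
    generalize D.potential x₁ = V1 at *
    generalize D.potential x₂ = V2 at *
    generalize D.potential y₁ = V3 at *
    generalize D.potential y₂ = V4 at *
    generalize D.potential z₁ = V5 at *
    generalize D.potential z₂ = V6 at *
    have half : ∀ {s t : ℤ}, 2 * s = 2 * t → s = t := fun h => by omega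
    replace k3 := half k3
    replace k4 := half k4
    replace k5 := half k5
    replace k6 := half k6
    replace l1 := half l1
    replace l2 := half l2
    replace l5 := half l5
    replace l6 := half l6
    replace m1 := half m1
    replace m2 := half m2
    replace m3 := half m3
    replace m4 := half m4
    subst k3 k4 k5 k6 l1 l2 l5 l6 m1 m2 m3 m4
    -- For each of the sixteen sign patterns the claims are linear in the remaining steps and
    -- potentials.
    rcases ua with ua | ua <;> rcases ub with ub | ub <;> rcases uc with uc | uc <;>
      rcases ud with ud | ud <;> simp only [ua, ub, uc, ud] at k1 k2 l3 l4 m5 m6 t u v ⊢ <;>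
      refine ⟨?_, ?_, ?_, ?_⟩ <;> linarith

theorem evenPart_r3 {D D' : GaussDiagram} {S : Set Chord} {x₁ x₂ y₁ y₂ z₁ z₂ : UnitAddCircle}
    {a b c δ : ℤˣ} (h : D.chords = S ∪ {⟨x₁, y₁, a⟩, ⟨x₂, z₁, b⟩, ⟨y₂, z₂, c⟩})
    (h' : D'.chords = S ∪ {⟨x₂, y₂, a⟩, ⟨x₁, z₂, b⟩, ⟨y₁, z₁, c⟩})
    (top : D.InOrder (δ * (a * b * c)) x₁ x₂) (middle : D.InOrder (δ * a) y₁ y₂)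
    (bottom : D.InOrder (δ * b) z₁ z₂) : Equivalent D.evenPart D'.evenPart := by
  obtain ⟨-, hS⟩ := r3_endpoints h h' top.adjacent.ne middle.adjacent.ne bottom.adjacent.ne
  obtain ⟨i0, i1, i2, i3, i4⟩ := r3_index h h' top middle bottom
  have m1 : (⟨x₁, y₁, a⟩ : Chord) ∈ D.chords := by simp [h]
  have m2 : (⟨x₂, z₁, b⟩ : Chord) ∈ D.chords := by simp [h]
  have m3 : (⟨y₂, z₂, c⟩ : Chord) ∈ D.chords := by simp [h]
  have hSn : ∀ (p r : UnitAddCircle) (s : ℤˣ), p ∈ [x₁, x₂, y₁, y₂, z₁, z₂] →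
      (⟨p, r, s⟩ : Chord) ∉ {d ∈ S | D.index d = 0} :=
    fun p r s hp hc => hS _ hc.1 p (Or.inl rfl) hp
  have hE : ∀ d, d ∈ D.evenPart.chords ↔ d ∈ {d ∈ S | D.index d = 0} ∨
      (d = ⟨x₁, y₁, a⟩ ∧ D.index ⟨x₁, y₁, a⟩ = 0) ∨ (d = ⟨x₂, z₁, b⟩ ∧ D.index ⟨x₂, z₁, b⟩ = 0) ∨
      (d = ⟨y₂, z₂, c⟩ ∧ D.index ⟨y₂, z₂, c⟩ = 0) := by
    intro d
    change d ∈ D.chords ∧ D.index d = 0 ↔ _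
    rw [h]
    simp only [Set.mem_union, Set.mem_insert_iff, Set.mem_singleton_iff, Set.mem_ofPred_eq]
    constructor
    · rintro ⟨h1 | rfl | rfl | rfl, h2⟩ <;> tauto
    · rintro (h1 | ⟨rfl, h1⟩ | ⟨rfl, h1⟩ | ⟨rfl, h1⟩) <;> tauto
  have hE' : ∀ d, d ∈ D'.evenPart.chords ↔ d ∈ {d ∈ S | D.index d = 0} ∨
      (d = ⟨x₂, y₂, a⟩ ∧ D.index ⟨x₁, y₁, a⟩ = 0) ∨ (d = ⟨x₁, z₂, b⟩ ∧ D.index ⟨x₂, z₁, b⟩ = 0) ∨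
      (d = ⟨y₁, z₁, c⟩ ∧ D.index ⟨y₂, z₂, c⟩ = 0) := by
    intro d
    change d ∈ D'.chords ∧ D'.index d = 0 ↔ _
    rw [h', ← i1, ← i2, ← i3]
    simp only [Set.mem_union, Set.mem_insert_iff, Set.mem_singleton_iff, Set.mem_ofPred_eq]
    constructor
    · rintro ⟨h1 | rfl | rfl | rfl, h2⟩
      · exact Or.inl ⟨h1, i0 d h1 ▸ h2⟩
      all_goals tauto
    · rintro (h1 | ⟨rfl, h1⟩ | ⟨rfl, h1⟩ | ⟨rfl, h1⟩)
      · exact ⟨Or.inl h1.1, (i0 d h1.1).trans h1.2⟩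
      all_goals tauto
  have hsub := D.evenPart_chords_subset
  by_cases ha : D.index ⟨x₁, y₁, a⟩ = 0 <;> by_cases hb : D.index ⟨x₂, z₁, b⟩ = 0 <;>
    by_cases hc : D.index ⟨y₂, z₂, c⟩ = 0
  · have e1 : (⟨x₁, y₁, a⟩ : Chord) ∈ D.evenPart.chords := ⟨m1, ha⟩
    have e2 : (⟨x₂, z₁, b⟩ : Chord) ∈ D.evenPart.chords := ⟨m2, hb⟩
    have e3 : (⟨y₂, z₂, c⟩ : Chord) ∈ D.evenPart.chords := ⟨m3, hc⟩
    refine Relation.EqvGen.rel _ _ (Move.r3 _ _ {d ∈ S | D.index d = 0} x₁ x₂ y₁ y₂ z₁ z₂ a b c δ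
      ?_ ?_ (top.mono hsub (tail_mem_endpoints e1) (tail_mem_endpoints e2))
      (middle.mono hsub (head_mem_endpoints e1) (tail_mem_endpoints e3))
      (bottom.mono hsub (head_mem_endpoints e2) (head_mem_endpoints e3)))
    · ext d
      simp [hE d, ha, hb, hc, or_comm, or_assoc]
    · ext d
      simp [hE' d, ha, hb, hc, or_comm, or_assoc]
  -- Exactly one odd chord contradicts the linear relation `i4`.
  · omega
  · omega
  -- Only the top-middle chord survives, and `x₂` and `y₂`, where its ends must go, were vacated by
  -- the two odd chords.
  · refine Relation.EqvGen.rel _ _ (move_of_adjacent (S := {d ∈ S | D.index d = 0}) hsub ?_ ?_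
      (hSn x₁ y₁ a (by simp)) top.adjacent middle.adjacent (notMem_evenPart_endpoints m2 hb).1
      (notMem_evenPart_endpoints m3 hc).1)
    · ext d
      simp [hE d, ha, hb, hc, or_comm]
    · ext d
      simp [hE' d, ha, hb, hc, or_comm]
  · omega
  · refine Relation.EqvGen.rel _ _ (move_of_adjacent (S := {d ∈ S | D.index d = 0}) hsub ?_ ?_
      (hSn x₂ z₁ b (by simp)) top.adjacent.symm bottom.adjacent
      (notMem_evenPart_endpoints m1 ha).1 (notMem_evenPart_endpoints m3 hc).2)
    · ext d
      simp [hE d, ha, hb, hc, or_comm]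
    · ext d
      simp [hE' d, ha, hb, hc, or_comm]
  · refine Relation.EqvGen.rel _ _ (move_of_adjacent (S := {d ∈ S | D.index d = 0}) hsub ?_ ?_
      (hSn y₂ z₂ c (by simp)) middle.adjacent.symm bottom.adjacent.symm
      (notMem_evenPart_endpoints m1 ha).2 (notMem_evenPart_endpoints m2 hb).2)
    · ext d
      simp [hE d, ha, hb, hc, or_comm]
    · ext d
      simp [hE' d, ha, hb, hc, or_comm]
  · have : D.evenPart = D'.evenPart := by
      apply GaussDiagram.ext
      ext d
      rw [hE, hE']
      simp [ha, hb, hc]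
    rw [this]
    exact Relation.EqvGen.refl _

/-! ### Invariance of the projection -/

theorem Move.evenPart_equivalent {D D' : GaussDiagram} (h : Move D D') :
    Equivalent D.evenPart D'.evenPart := by
  cases h with
  | isotopy f inj orientation chords_eq =>
    exact Relation.EqvGen.rel _ _ (evenPart_isotopy inj orientation chords_eq)
  | r1 c new chords_eq adj => exact Relation.EqvGen.rel _ _ (evenPart_r1 new chords_eq adj)
  | r2 c d newc newd chords_eq opposite adj_tail adj_head =>
    exact evenPart_r2 newc newd chords_eq opposite adj_tail adj_head
  | r3 S x₁ x₂ y₁ y₂ z₁ z₂ a b c δ chords_eq chords_eq' top middle bottom =>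
    exact evenPart_r3 chords_eq chords_eq' top middle bottom

/-- The even parts of equivalent Gauss diagrams are equivalent. -/
theorem Equivalent.evenPart {D D' : GaussDiagram} (h : Equivalent D D') :
    Equivalent D.evenPart D'.evenPart := by
  induction h with
  | rel _ _ h => exact h.evenPart_equivalent
  | refl _ => exact Relation.EqvGen.refl _
  | symm _ _ _ ih => exact Relation.EqvGen.symm _ _ ih
  | trans _ _ _ _ _ ih ih' => exact Relation.EqvGen.trans _ _ _ ih ih'

theorem Equivalent.iterate_evenPart {D D' : GaussDiagram} (h : Equivalent D D') (n : ℕ) :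
    Equivalent (GaussDiagram.evenPart^[n] D) (GaussDiagram.evenPart^[n] D') := by
  induction n with
  | zero => exact h
  | succ n ih => simpa only [Function.iterate_succ_apply'] using ih.evenPart

end GaussDiagram

/-! ### Lifts of maps of the circle -/

theorem exists_circleMap {F : ℝ → ℝ} {m : ℕ} (hF : ∀ t, F (t + 1) = F t + m) :
    ∃ f : UnitAddCircle → UnitAddCircle, ∀ t : ℝ, f t = F t := by
  refine ⟨fun x => F (circleRep x), fun t => ?_⟩
  obtain ⟨n, hn⟩ := coe_eq_iff_exists_int.1 (coe_circleRep t)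
  have hadd : ∀ k : ℤ, F (t + k) = F t + ((k * m : ℤ) : ℝ) := by
    intro k
    induction k using Int.induction_on with
    | zero => simp
    | succ i ih =>
      have h := hF (t + (i : ℤ))
      rw [ih] at h
      push_cast at h ⊢
      rw [← add_assoc, h]
      ring
    | pred i ih =>
      have h := hF (t + ((-i - 1 : ℤ) : ℝ))
      rw [show t + ((-(i : ℤ) - 1 : ℤ) : ℝ) + 1 = t + ((-(i : ℤ) : ℤ) : ℝ) by push_cast; ring,
        ih] at h
      push_cast at h ⊢
      linarith
  change (F (circleRep t) : UnitAddCircle) = F t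
  rw [hn, hadd, coe_add_int]

theorem surjective_of_add_one {F : ℝ → ℝ} {m : ℕ} (hm : 0 < m) (hc : Continuous F)
    (hF : ∀ t, F (t + 1) = F t + m) : Function.Surjective F := by
  have hup : ∀ n : ℕ, F n = F 0 + n * m := by
    intro n
    induction n with
    | zero => simp
    | succ n ih => push_cast; rw [hF, ih]; ring
  have hdown : ∀ n : ℕ, F (-n) = F 0 - n * m := by
    intro n
    induction n with
    | zero => simp
    | succ n ih =>
      have h := hF (-((n + 1 : ℕ) : ℝ))
      rw [show -((n + 1 : ℕ) : ℝ) + 1 = -(n : ℝ) by push_cast; ring, ih] at h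
      push_cast at h ⊢
      linarith
  intro y
  have hm1 : (1 : ℝ) ≤ m := by exact_mod_cast hm
  obtain ⟨n, hn⟩ := exists_nat_ge |y - F 0|
  have hnm : (n : ℝ) ≤ n * m := le_mul_of_one_le_right (Nat.cast_nonneg n) hm1
  have h1 := abs_le.1 hn
  refine mem_range_of_exists_le_of_exists_ge hc ⟨-n, ?_⟩ ⟨n, ?_⟩
  · rw [hdown]; linarith
  · rw [hup]; linarith

theorem circleMap_injective {F : ℝ → ℝ} {f : UnitAddCircle → UnitAddCircle} (hmono : StrictMono F)
    (hF : ∀ t, F (t + 1) = F t + 1) (hf : ∀ t : ℝ, f t = F t) : Function.Injective f := by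
  intro x y h
  obtain ⟨s, -, -, rfl⟩ := exists_lift 0 x
  obtain ⟨t, h1, h2, rfl⟩ := exists_lift s y
  rw [hf, hf] at h
  obtain ⟨n, hn⟩ := coe_eq_iff_exists_int.1 h
  have h3 := hmono.monotone h1
  have h4 := hmono h2
  rw [hF] at h4
  have h5 : (-1 : ℤ) < n := by
    have : ((-1 : ℤ) : ℝ) < n := by push_cast; linarith
    exact_mod_cast this
  have h6 : n ≤ (0 : ℤ) := by
    have : (n : ℝ) ≤ (0 : ℤ) := by push_cast; linarith
    exact_mod_cast this
  have h7 : n = 0 := by omega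
  rw [h7, Int.cast_zero, add_zero] at hn
  rw [hmono.injective hn]

theorem sbtw_circleMap {F : ℝ → ℝ} {f : UnitAddCircle → UnitAddCircle} (hmono : StrictMono F)
    (hF : ∀ t, F (t + 1) = F t + 1) (hf : ∀ t : ℝ, f t = F t) (x y z : UnitAddCircle) :
    sbtw (f x) (f y) (f z) ↔ sbtw x y z := by
  obtain ⟨a, -, -, rfl⟩ := exists_lift 0 x
  obtain ⟨b, hb, hb', rfl⟩ := exists_lift a y
  obtain ⟨c, hc, hc', rfl⟩ := exists_lift a z
  rw [hf, hf, hf, sbtw_coe_iff hb hb' hc hc', sbtw_coe_iff (hmono.monotone hb) (hF a ▸ hmono hb')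
    (hmono.monotone hc) (hF a ▸ hmono hc'), hmono.lt_iff_lt, hmono.lt_iff_lt]

/-! ### Coverings of Gauss diagrams. -/

namespace GaussDiagram

theorem next_of_covering {D D' : GaussDiagram} {P : ℝ → ℝ} {f : UnitAddCircle → UnitAddCircle}
    (hmono : StrictMono P) (hsurj : Function.Surjective P) (hf : ∀ t : ℝ, f t = P t)
    (hE : ∀ x, f x ∈ D'.endpoints ↔ x ∈ D.endpoints) {x y : UnitAddCircle} (h : D.Next x y) :
    D'.Next (f x) (f y) := by
  obtain ⟨hx, hy, hne, hxy⟩ := h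
  obtain ⟨s, -, -, rfl⟩ := exists_lift 0 x
  obtain ⟨t, h1, h2, rfl⟩ := exists_lift s y
  have hst : s < t := h1.lt_of_ne fun h => hne (h ▸ rfl)
  have hgap : ∀ r, s < r → r < t → (P r : UnitAddCircle) ∉ D'.endpoints := by
    intro r hr hr' hrE
    rw [← hf, hE] at hrE
    exact hxy r ((mem_cIoo_coe_iff hst h2).2 ⟨r, hr, hr', rfl⟩) hrE
  have hsE := (hE s).2 hx
  -- The image of a short arc could fail to be short only by wrapping once around. Then `P s` would
  -- be the sole endpoint of `D'`, but a chord has two.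
  have hlt : P t < P s + 1 := by
    by_contra! hge
    obtain ⟨u, hu⟩ := hsurj (P s + 1)
    have hus : (P u : UnitAddCircle) = P s := by
      rw [hu]; simp
    have hut : u = t := by
      by_contra hne'
      have h3 : u < t := (hmono.le_iff_le.1 (hu ▸ hge)).lt_of_ne hne'
      have h4 : s < u := hmono.lt_iff_lt.1 (by rw [hu]; linarith)
      refine hgap u h4 h3 ?_
      rwa [hus, ← hf]
    have hall : ∀ z ∈ D'.endpoints, z = P s := by
      intro z hz
      obtain ⟨v, hv, hv', rfl⟩ := exists_lift (P s) z
      obtain ⟨w, rfl⟩ := hsurj v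
      rcases (hmono.le_iff_le.1 hv).eq_or_lt with rfl | hw
      · rfl
      · refine absurd hz (hgap w hw (hmono.lt_iff_lt.1 ?_))
        rwa [← hut, hu]
    obtain ⟨c, hc, -⟩ := hsE
    exact D'.tail_ne_head c hc c hc
      ((hall _ (tail_mem_endpoints hc)).trans (hall _ (head_mem_endpoints hc)).symm)
  refine ⟨hsE, (hE t).2 hy, ?_, ?_⟩
  · rw [hf, hf]
    intro h
    obtain ⟨n, hn⟩ := coe_eq_iff_exists_int.1 h
    have h3 := hmono hst
    have h4 : (-1 : ℤ) < n := by
      have : ((-1 : ℤ) : ℝ) < n := by push_cast; linarith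
      exact_mod_cast this
    have h5 : n < (0 : ℤ) := by
      have : (n : ℝ) < (0 : ℤ) := by push_cast; linarith
      exact_mod_cast this
    omega
  · rw [hf, hf]
    intro z hz
    obtain ⟨v, hv, hv', rfl⟩ := (mem_cIoo_coe_iff (hmono hst) hlt).1 hz
    obtain ⟨w, rfl⟩ := hsurj v
    exact hgap w (hmono.lt_iff_lt.1 hv) (hmono.lt_iff_lt.1 hv')

/-- The index of a chord is preserved by a map of the circle that maps chords to chords and short
arcs to short arcs. -/
theorem index_covering {D D' : GaussDiagram} {f : UnitAddCircle → UnitAddCircle}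
    (hmap : ∀ c ∈ D.chords, c.map f ∈ D'.chords)
    (hnext : ∀ x y, D.Next x y → D'.Next (f x) (f y)) {c : Chord} (hc : c ∈ D.chords) :
    D'.index (c.map f) = D.index c := by
  have hjump : ∀ y ∈ D.endpoints, D'.jump (f y) = D.jump y := by
    rintro y ⟨d, hd, rfl | rfl⟩
    · rw [jump_tail hd]
      exact jump_tail (hmap d hd)
    · rw [jump_head hd]
      exact jump_head (hmap d hd)
  -- Matching jumps along matching short arcs make this difference constant.
  have h := eq_of_forall_next (D := D) (f := fun x => D'.potential (f x) - D.potential x)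
    (fun x y hxy => by
      rw [hxy.potential_eq, (hnext x y hxy).potential_eq, hjump y hxy.2.1]; ring)
    (tail_mem_endpoints hc) (head_mem_endpoints hc)
  rw [index_eq_potential hc, index_eq_potential (hmap c hc)]
  simp only [Chord.map]
  linarith

end GaussDiagram

/-! ### Plane geometry -/

theorem planeDet_smul (r s : ℝ) (z w : ℂ) : planeDet (r • z) (s • w) = r * s * planeDet z w := by
  simp only [planeDet, Complex.real_smul, Complex.mul_re, Complex.mul_im, Complex.ofReal_re,
    Complex.ofReal_im]
  ring

theorem planeDet_mul (a z w : ℂ) : planeDet (a * z) (a * w) = Complex.normSq a * planeDet z w := by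
  simp only [planeDet, Complex.mul_re, Complex.mul_im, Complex.normSq_apply]
  ring

theorem hasDerivAt_norm {z : ℝ → ℂ} {v : ℂ} {t : ℝ} (h : HasDerivAt z v t) (h0 : z t ≠ 0) :
    HasDerivAt (fun t => ‖z t‖) (‖z t‖ * (v / z t).re) t := by
  have h1 := h.norm_sq.sqrt (by simpa using h0)
  have h2 : (fun t => √(‖z t‖ ^ 2)) = fun t => ‖z t‖ := by
    funext t
    exact Real.sqrt_sq (norm_nonneg _)
  rw [h2] at h1
  convert h1 using 1
  have hn : ‖z t‖ ≠ 0 := norm_ne_zero_iff.2 h0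
  rw [Real.sqrt_sq (norm_nonneg _), Complex.inner, Complex.div_re, Complex.normSq_eq_norm_sq]
  simp only [Complex.mul_re, Complex.conj_re, Complex.conj_im]
  field_simp
  ring

namespace VirtualKnotDiagram

/-- In the coordinate `log z` the map keeps the radial part and multiplies the angular part by `q`,
so the logarithmic derivative changes accordingly. -/
theorem hasDerivAt_unfold (q : ℕ) {z : ℝ → ℂ} {v : ℂ} {t : ℝ} (h : HasDerivAt z v t)
    (h0 : z t ≠ 0) : HasDerivAt (fun t => unfold q (z t))
      (unfold q (z t) * (((v / z t).re : ℂ) + q * (v / z t).im * Complex.I)) t := by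
  have hn := (hasDerivAt_norm h h0).ofReal_comp
  have hne : ((‖z t‖ : ℝ) : ℂ) ≠ 0 := by exact_mod_cast norm_ne_zero_iff.2 h0
  have h1 := hn.mul ((h.div hn hne).pow q)
  refine (h1.congr_deriv ?_)
  have hv : v = z t * (v / z t) := by field_simp
  have ha : v / z t = ((v / z t).re : ℂ) + (v / z t).im * Complex.I := (Complex.re_add_im _).symm
  generalize v / z t = a at *
  subst hv
  simp only [Pi.pow_apply, Pi.div_apply, unfold]
  set n : ℂ := ((‖z t‖ : ℝ) : ℂ)
  push_cast
  rcases q with _ | q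
  · simp only [Nat.cast_zero, pow_zero, zero_mul, mul_zero, add_zero, mul_one]
    rfl
  · simp only [Nat.add_sub_cancel, pow_succ]
    nth_rewrite 2 [ha]
    field_simp
    push_cast
    ring

theorem hasDerivAt_curve (K : VirtualKnotDiagram) (t : ℝ) :
    HasDerivAt (fun t : ℝ => K.curve t) (K.velocity t) t :=
  (K.smooth.differentiable (by simp) t).hasDerivAt

/-- Stretching the imaginary axis has determinant `q` and multiplication by `w` has determinant
`|w|²`. For `q > 0` and `w ≠ 0` orientation, hence crossing sign, is kept. -/
theorem planeDet_unfold {q : ℕ} (w a b : ℂ) :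
    planeDet (w * ((a.re : ℂ) + q * a.im * Complex.I)) (w * ((b.re : ℂ) + q * b.im * Complex.I)) =
      Complex.normSq w * q * planeDet a b := by
  rw [planeDet_mul]
  simp [planeDet]
  ring

theorem unfold_ne_zero (q : ℕ) {z : ℂ} (h : z ≠ 0) : unfold q z ≠ 0 := by
  have : (‖z‖ : ℂ) ≠ 0 := by exact_mod_cast norm_ne_zero_iff.2 h
  exact mul_ne_zero this (pow_ne_zero _ (div_ne_zero h this))

theorem norm_unfold (q : ℕ) (z : ℂ) : ‖unfold q z‖ = ‖z‖ := by
  by_cases h : z = 0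
  · simp [unfold, h]
  · have : ‖z‖ ≠ 0 := norm_ne_zero_iff.2 h
    simp [unfold, this]

theorem exists_rotation_of_unfold_eq {q : ℕ} (hq : 0 < q) {z w : ℂ} (hw : w ≠ 0)
    (h : unfold q z = unfold q w) : ∃ j : ℕ, z = rotation q ^ j * w := by
  have hn : ‖z‖ = ‖w‖ := by rw [← norm_unfold q z, h, norm_unfold]
  have hne : (‖w‖ : ℂ) ≠ 0 := by exact_mod_cast norm_ne_zero_iff.2 hw
  have h1 : (z / w) ^ q = 1 := by
    unfold unfold at h
    rw [hn] at h
    have h2 := mul_left_cancel₀ hne h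
    rw [div_pow, div_pow] at h2
    field_simp at h2
    rw [div_pow, h2, div_self (pow_ne_zero _ hw)]
  have : NeZero q := ⟨hq.ne'⟩
  obtain ⟨j, -, hj⟩ := (Complex.isPrimitiveRoot_exp q hq.ne').eq_pow_of_pow_eq_one h1
  refine ⟨j, ?_⟩
  rw [rotation, hj, div_mul_cancel₀ _ hw]

/-! ### Crossings -/

/-- At a double point only one of the two parameters is an over-parameter, so the point determines
the chord. -/
theorem eq_of_crossingPoint_eq {K : VirtualKnotDiagram} {c d : Chord} (hc : c ∈ K.gauss.chords)
    (hd : d ∈ K.gauss.chords) (h : K.crossingPoint c = K.crossingPoint d) : c = d := by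
  refine K.chord_eq_of_tail_eq hc hd ?_
  by_contra hne
  obtain ⟨y, hy, hyd, hyo⟩ := K.over_crossing d.tail hd.1
  exact hyo (K.head_unique hne hy h hyd ▸ hc.1)

theorem exists_chord_of_mem_over (K : VirtualKnotDiagram) {x : UnitAddCircle}
    (hx : x ∈ K.overSet) : ∃ c ∈ K.gauss.chords, c.tail = x := by
  obtain ⟨y, hy, hxy, -⟩ := K.over_crossing x hx
  obtain ⟨s, -, -, rfl⟩ := exists_lift 0 x
  obtain ⟨t, -, -, rfl⟩ := exists_lift 0 y
  rcases (K.transverse s t hy.symm hxy.symm).lt_or_gt with h | h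
  · exact ⟨⟨s, t, -1⟩, ⟨hx, hy, hxy, s, t, rfl, rfl, by simpa [velocity] using h⟩, rfl⟩
  · exact ⟨⟨s, t, 1⟩, ⟨hx, hy, hxy, s, t, rfl, rfl, by simpa [velocity] using h⟩, rfl⟩

theorem mem_endpoints_of_curve_eq {K : VirtualKnotDiagram} {c : Chord} (hc : c ∈ K.gauss.chords)
    {x : UnitAddCircle} (h : K.curve x = K.crossingPoint c) : x ∈ K.gauss.endpoints := by
  by_cases hx : x = c.tail
  · exact hx ▸ GaussDiagram.tail_mem_endpoints hc
  · exact K.head_unique hc.2.1 hx hc.2.2.1 h ▸ GaussDiagram.head_mem_endpoints hc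

/-- Shared by the rotation and the quotient map: positive speed and a positive determinant factor
preserve the crossing sign. -/
theorem map_mem_chords {K L : VirtualKnotDiagram} {F : ℝ → ℝ} {f : UnitAddCircle → UnitAddCircle}
    (hf : ∀ t : ℝ, f t = F t) (hF : Differentiable ℝ F) (hpos : ∀ t, 0 < deriv F t)
    (hover : ∀ x, f x ∈ L.overSet ↔ x ∈ K.overSet)
    (hcurve : ∀ x y, K.curve x = K.curve y → L.curve (f x) = L.curve (f y)) {E : ℝ → ℂ}
    (hE : ∀ t, HasDerivAt (fun t => L.curve (F t)) (E t) t)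
    (hdet : ∀ s t : ℝ, K.curve s = K.curve t →
      ∃ r : ℝ, 0 < r ∧ planeDet (E s) (E t) = r * planeDet (K.velocity s) (K.velocity t))
    {c : Chord} (hc : c ∈ K.gauss.chords) : c.map f ∈ L.gauss.chords := by
  have hhead := K.head_notMem_over hc
  obtain ⟨h1, h2, h3, s, t, hs, ht, h4⟩ := hc
  have hvel : ∀ t, E t = deriv F t • L.velocity (F t) := fun t =>
    (hE t).unique ((L.hasDerivAt_curve (F t)).scomp t (hF t).hasDerivAt)
  refine ⟨(hover _).2 h1, fun h => ?_, hcurve _ _ h3, F s, F t, ?_, ?_, ?_⟩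
  · exact hhead ((hover _).1 (show f c.head ∈ _ from (show f c.head = f c.tail from h) ▸
      (hover _).2 h1))
  · rw [← hf, ← hs]; rfl
  · rw [← hf, ← ht]; rfl
  · obtain ⟨r, hr, hrs⟩ := hdet s t (by rw [← hs, ← ht, h3])
    rw [hvel, hvel, planeDet_smul] at hrs
    have hp := mul_pos (hpos s) (hpos t)
    have h5 : 0 < (deriv F s * deriv F t) *
        (((c.sign : ℤ) : ℝ) * planeDet (L.velocity (F s)) (L.velocity (F t))) := by
      calc 0 < r * (((c.sign : ℤ) : ℝ) * planeDet (K.velocity s) (K.velocity t)) := mul_pos hr h4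
        _ = _ := by linear_combination (-((c.sign : ℤ) : ℝ)) * hrs
    exact (pos_iff_pos_of_mul_pos h5).1 hp

/-! ### Periodic diagrams -/

theorem norm_rotation (q : ℕ) : ‖rotation q‖ = 1 := by
  have : (2 * Real.pi * Complex.I / q : ℂ) = ((2 * Real.pi / q : ℝ) : ℂ) * Complex.I := by
    push_cast; ring
  rw [rotation, this, Complex.norm_exp_ofReal_mul_I]

/-- The rotation of a periodic diagram acts on its parameter circle and on its chords. -/
theorem IsPeriodic.exists_rotation {K : VirtualKnotDiagram} {q : ℕ} (hK : K.IsPeriodic q) :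
    ∃ f : UnitAddCircle → UnitAddCircle,
      (∀ x, K.curve (f x) = rotation q * K.curve x) ∧
      ∀ c ∈ K.gauss.chords, c.map f ∈ K.gauss.chords ∧
        K.gauss.index (c.map f) = K.gauss.index c := by
  obtain ⟨h0, Φ, hΦ, hpos, hadd, hrot⟩ := hK
  obtain ⟨f, hf⟩ := exists_circleMap (F := Φ) (m := 1) (by simpa using hadd)
  have hmono := strictMono_of_deriv_pos hpos
  have hcurve : ∀ x, K.curve (f x) = rotation q * K.curve x := by
    intro x
    obtain ⟨t, -, -, rfl⟩ := exists_lift 0 x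
    rw [hf, (hrot t).1]
  have hover : ∀ x, f x ∈ K.overSet ↔ x ∈ K.overSet := by
    intro x
    obtain ⟨t, -, -, rfl⟩ := exists_lift 0 x
    rw [hf, (hrot t).2]
  have hmap : ∀ c ∈ K.gauss.chords, c.map f ∈ K.gauss.chords := fun c hc =>
    map_mem_chords hf (hΦ.differentiable (by simp)) hpos hover
      (fun x y h => by rw [hcurve, hcurve, h])
      (fun t => (((K.hasDerivAt_curve t).const_mul (rotation q)).congr_of_eventuallyEq
        (Filter.Eventually.of_forall fun t => (hrot t).1)))
      (fun s t _ => ⟨1, one_pos, by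
        rw [planeDet_mul, Complex.normSq_eq_norm_sq, norm_rotation, one_pow]⟩) hc
  have hinj := circleMap_injective hmono hadd hf
  have hinj' : Set.InjOn (Chord.map f) K.gauss.chords := fun c hc d hd h =>
    K.gauss.tail_injOn hc hd (hinj (congrArg Chord.tail h))
  have hsub : Chord.map f '' K.gauss.chords ⊆ K.gauss.chords := Set.image_subset_iff.2 hmap
  -- An injective self-map of a finite set is onto, so the rotation is an isotopy of the diagram to
  -- itself.
  have himage : K.gauss.chords = Chord.map f '' K.gauss.chords :=
    (Set.eq_of_subset_of_ncard_le hsub (hinj'.ncard_image).ge K.gauss.finite).symm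
  exact ⟨f, hcurve, fun c hc => ⟨hmap c hc, GaussDiagram.index_isotopy hinj.injOn
    (fun x _ y _ z _ => sbtw_circleMap hmono hadd hf x y z) himage hc⟩⟩

theorem IsPeriodic.exists_chord {K : VirtualKnotDiagram} {q : ℕ} (hK : K.IsPeriodic q)
    {c : Chord} (hc : c ∈ K.gauss.chords) (j : ℕ) : ∃ d ∈ K.gauss.chords,
      K.crossingPoint d = rotation q ^ j * K.crossingPoint c ∧
        K.gauss.index d = K.gauss.index c := by
  obtain ⟨f, hcurve, hf⟩ := hK.exists_rotation
  induction j with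
  | zero => exact ⟨c, hc, by simp, rfl⟩
  | succ j ih =>
    obtain ⟨d, hd, h1, h2⟩ := ih
    refine ⟨d.map f, (hf d hd).1, ?_, (hf d hd).2.trans h2⟩
    rw [pow_succ', mul_assoc, ← h1]
    exact hcurve d.tail

theorem IsPeriodic.index_eq {K : VirtualKnotDiagram} {q : ℕ} (hK : K.IsPeriodic q) {c d : Chord}
    (hc : c ∈ K.gauss.chords) (hd : d ∈ K.gauss.chords) {j : ℕ}
    (h : K.crossingPoint d = rotation q ^ j * K.crossingPoint c) :
    K.gauss.index d = K.gauss.index c := by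
  obtain ⟨e, he, h1, h2⟩ := hK.exists_chord hc j
  rw [eq_of_crossingPoint_eq hd he (h.trans h1.symm), h2]

/-! ### Projections of periodic diagrams -/

theorem gauss_projection (K : VirtualKnotDiagram) : K.projection.gauss = K.gauss.evenPart := by
  apply GaussDiagram.ext
  ext c
  constructor
  · rintro ⟨⟨d, hd, h1, h2⟩, h3⟩
    have hc : c ∈ K.gauss.chords := ⟨h1 ▸ hd.1, h3⟩
    have hdc : d = c := K.chord_eq_of_tail_eq hd hc h1
    exact ⟨hc, hdc ▸ h2⟩
  · rintro ⟨hc, h⟩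
    exact ⟨⟨c, hc, rfl, h⟩, hc.2⟩

theorem gauss_iterate_projection (K : VirtualKnotDiagram) (n : ℕ) :
    (projection^[n] K).gauss = GaussDiagram.evenPart^[n] K.gauss := by
  induction n with
  | zero => rfl
  | succ n ih => rw [Function.iterate_succ_apply', gauss_projection, ih,
      Function.iterate_succ_apply']

/-- The same lift `Φ` works, because a crossing and its rotated copy have equal index and are kept
or deleted together. -/
theorem IsPeriodic.projection {K : VirtualKnotDiagram} {q : ℕ} (hK : K.IsPeriodic q) :
    K.projection.IsPeriodic q := by
  have hK' := hK
  obtain ⟨h0, Φ, hΦ, hpos, hadd, hrot⟩ := hK'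
  refine ⟨h0, Φ, hΦ, hpos, hadd, fun t => ⟨(hrot t).1, ?_⟩⟩
  have key : ∀ c ∈ K.gauss.chords, ∀ d ∈ K.gauss.chords, c.tail = (Φ t : UnitAddCircle) →
      d.tail = (t : UnitAddCircle) → K.gauss.index c = K.gauss.index d := fun c hc d hd h1 h2 =>
    hK.index_eq hd hc (j := 1) (by
      rw [crossingPoint, crossingPoint, h1, h2, pow_one, (hrot t).1])
  constructor
  · rintro ⟨c, hc, h1, h2⟩
    obtain ⟨d, hd, h3⟩ := K.exists_chord_of_mem_over ((hrot t).2.1 (h1 ▸ hc.1))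
    exact ⟨d, hd, h3, (key c hc d hd h1 h3).symm.trans h2⟩
  · rintro ⟨d, hd, h1, h2⟩
    obtain ⟨c, hc, h3⟩ := K.exists_chord_of_mem_over ((hrot t).2.2 (h1 ▸ hd.1))
    exact ⟨c, hc, h3, (key c hc d hd h3 h1).trans h2⟩

theorem exists_stableProjection_eq (K : VirtualKnotDiagram) :
    ∃ n : ℕ, K.stableProjection = projection^[n] K := ⟨_, rfl⟩

theorem IsPeriodic.stableProjection {K : VirtualKnotDiagram} {q : ℕ} (hK : K.IsPeriodic q) :
    K.stableProjection.IsPeriodic q := by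
  obtain ⟨n, hn⟩ := K.exists_stableProjection_eq
  rw [hn]
  clear hn
  induction n with
  | zero => exact hK
  | succ n ih => rw [Function.iterate_succ_apply']; exact ih.projection

theorem projection_stableProjection (K : VirtualKnotDiagram) :
    K.stableProjection.projection = K.stableProjection := by
  classical
  have h := Nat.find_spec K.exists_projection_stable
  rwa [Function.iterate_succ_apply'] at h

theorem isAlmostClassical_stableProjection (K : VirtualKnotDiagram) :
    K.stableProjection.IsAlmostClassical := by
  refine GaussDiagram.isAlmostClassical_iff.2 fun c hc => ?_
  rw [← projection_stableProjection, gauss_projection] at hc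
  exact hc.2

theorem RepresentsAlmostClassical.virtuallyIsotopic_stableProjection {K : VirtualKnotDiagram}
    (h : K.RepresentsAlmostClassical) : K.stableProjection.VirtuallyIsotopic K := by
  obtain ⟨L, hKL, hL⟩ := h
  obtain ⟨n, hn⟩ := K.exists_stableProjection_eq
  rw [VirtuallyIsotopic, hn, gauss_iterate_projection]
  have h1 := GaussDiagram.Equivalent.iterate_evenPart hKL n
  rw [Function.iterate_fixed (GaussDiagram.evenPart_eq_self hL)] at h1
  exact Relation.EqvGen.trans _ _ _ h1 (Relation.EqvGen.symm _ _ hKL)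

/-! ### Quotients of periodic diagrams -/

/-- The quotient map acts on the parameter circle, maps chords to chords and preserves their
indices. -/
theorem IsQuotient.exists_covering {K L : VirtualKnotDiagram} {q : ℕ} (hq : 0 < q)
    (hK : K.IsPeriodic q) (h : K.IsQuotient q L) :
    ∃ f : UnitAddCircle → UnitAddCircle, Function.Surjective f ∧
      (∀ x, L.curve (f x) = unfold q (K.curve x)) ∧ (∀ x, f x ∈ L.overSet ↔ x ∈ K.overSet) ∧
      ∀ c ∈ K.gauss.chords, c.map f ∈ L.gauss.chords ∧
        L.gauss.index (c.map f) = K.gauss.index c := by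
  obtain ⟨P, hP, hpos, hadd, hquot⟩ := h
  obtain ⟨f, hf⟩ := exists_circleMap hadd
  have hsurj := surjective_of_add_one hq hP.continuous hadd
  have hmono := strictMono_of_deriv_pos hpos
  have hfsurj : Function.Surjective f := by
    intro y
    obtain ⟨t, -, -, rfl⟩ := exists_lift 0 y
    obtain ⟨s, rfl⟩ := hsurj t
    exact ⟨s, hf s⟩
  have hcurve : ∀ x, L.curve (f x) = unfold q (K.curve x) := by
    intro x
    obtain ⟨t, -, -, rfl⟩ := exists_lift 0 x
    rw [hf, (hquot t).1]
  have hover : ∀ x, f x ∈ L.overSet ↔ x ∈ K.overSet := by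
    intro x
    obtain ⟨t, -, -, rfl⟩ := exists_lift 0 x
    rw [hf, (hquot t).2]
  have hmap : ∀ c ∈ K.gauss.chords, c.map f ∈ L.gauss.chords := fun c hc =>
    map_mem_chords hf (hP.differentiable (by simp)) hpos hover
      (fun x y h => by rw [hcurve, hcurve, h])
      (fun t => ((hasDerivAt_unfold q (K.hasDerivAt_curve t) (hK.1 t)).congr_of_eventuallyEq
        (Filter.Eventually.of_forall fun t => (hquot t).1)))
      (fun s t hst => by
        have hz := hK.1 t
        -- The last factor comes from dividing both velocities by the common crossing point.
        refine ⟨Complex.normSq (unfold q (K.curve t)) * q * Complex.normSq (K.curve t)⁻¹, ?_, ?_⟩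
        · exact mul_pos (mul_pos (Complex.normSq_pos.2 (unfold_ne_zero q hz))
            (by exact_mod_cast hq)) (Complex.normSq_pos.2 (inv_ne_zero hz))
        · rw [hst, planeDet_unfold, div_eq_inv_mul, div_eq_inv_mul, planeDet_mul]
          ring) hc
  -- For the forward direction, the over-parameter of the crossing of `L` lifts to a chord of `K`.
  -- Any other preimage of the crossing point differs from its crossing by a rotation, where
  -- periodicity provides a chord.
  have hE : ∀ x, f x ∈ L.gauss.endpoints ↔ x ∈ K.gauss.endpoints := by
    intro x
    constructor
    · rintro ⟨d, hd, hdx⟩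
      obtain ⟨y, hy⟩ := hfsurj d.tail
      have hyo : y ∈ K.overSet := (hover y).1 (hy ▸ hd.1)
      obtain ⟨c, hc, rfl⟩ := K.exists_chord_of_mem_over hyo
      have hL : L.curve (f x) = L.curve (f c.tail) := by
        rw [hy]
        rcases hdx with h | h
        · rw [h]
        · rw [← h, hd.2.2.1]
      rw [hcurve, hcurve] at hL
      obtain ⟨j, hj⟩ := exists_rotation_of_unfold_eq hq (hK.1 _) hL
      obtain ⟨e, he, h1, -⟩ := hK.exists_chord hc j
      exact mem_endpoints_of_curve_eq he (hj.trans h1.symm)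
    · rintro ⟨c, hc, rfl | rfl⟩
      · exact GaussDiagram.tail_mem_endpoints (hmap c hc)
      · exact GaussDiagram.head_mem_endpoints (hmap c hc)
  exact ⟨f, hfsurj, hcurve, hover, fun c hc => ⟨hmap c hc, GaussDiagram.index_covering hmap
    (fun x y hxy => GaussDiagram.next_of_covering hmono hsurj hf hE hxy) hc⟩⟩

end VirtualKnotDiagram

theorem mainTheorem3 (q : ℕ) (hq : 0 < q) (K : VirtualKnotDiagram) (hK : K.IsPeriodic q) :
    -- the stable projection
    (K.RepresentsAlmostClassical →
      K.stableProjection.IsPeriodic q ∧ K.stableProjection.IsAlmostClassical ∧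
        K.stableProjection.VirtuallyIsotopic K) ∧
    -- the index is constant on the orbits of the rotation
    (∀ c ∈ K.gauss.chords, ∀ d ∈ K.gauss.chords, ∀ j : ℕ,
      K.crossingPoint d = VirtualKnotDiagram.rotation q ^ j * K.crossingPoint c →
        K.gauss.index d = K.gauss.index c) ∧
    -- the quotient
    (∀ L : VirtualKnotDiagram, K.IsQuotient q L →
      (∀ c ∈ K.gauss.chords, ∃ d ∈ L.gauss.chords,
        L.crossingPoint d = VirtualKnotDiagram.unfold q (K.crossingPoint c)) ∧
      (∀ d ∈ L.gauss.chords, ∃ c ∈ K.gauss.chords,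
        L.crossingPoint d = VirtualKnotDiagram.unfold q (K.crossingPoint c)) ∧
      (∀ c ∈ K.gauss.chords, ∀ d ∈ L.gauss.chords,
        L.crossingPoint d = VirtualKnotDiagram.unfold q (K.crossingPoint c) →
          K.gauss.index c = L.gauss.index d) ∧
      (K.IsAlmostClassical → L.IsAlmostClassical)) := by

  refine ⟨fun h => ⟨hK.stableProjection, K.isAlmostClassical_stableProjection,
    h.virtuallyIsotopic_stableProjection⟩, fun c hc d hd j h => hK.index_eq hc hd h,
    fun L hL => ?_⟩
  obtain ⟨f, hsurj, hcurve, hover, hmap⟩ := hL.exists_covering hq hK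
  -- Lifting the tail suffices, since a chord is determined by its tail.
  have hlift : ∀ d ∈ L.gauss.chords, ∃ c ∈ K.gauss.chords, c.map f = d := by
    intro d hd
    obtain ⟨x, hx⟩ := hsurj d.tail
    obtain ⟨c, hc, rfl⟩ := K.exists_chord_of_mem_over ((hover x).1 (hx ▸ hd.1))
    exact ⟨c, hc, L.chord_eq_of_tail_eq (hmap c hc).1 hd hx⟩
  refine ⟨fun c hc => ⟨c.map f, (hmap c hc).1, hcurve c.tail⟩, fun d hd => ?_,
    fun c hc d hd h => ?_, fun hAC => ?_⟩
  · obtain ⟨c, hc, rfl⟩ := hlift d hd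
    exact ⟨c, hc, hcurve c.tail⟩
  · have hd' : d = c.map f := VirtualKnotDiagram.eq_of_crossingPoint_eq hd (hmap c hc).1
      (h.trans (hcurve c.tail).symm)
    rw [hd', (hmap c hc).2]
  · refine GaussDiagram.isAlmostClassical_iff.2 fun d hd => ?_
    obtain ⟨c, hc, rfl⟩ := hlift d hd
    rw [(hmap c hc).2]
    exact GaussDiagram.isAlmostClassical_iff.1 hAC c hc
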